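/- For a compact operator $K$ on a complex Hilbert space $\mathcal H$ let $s_1(K)\ge s_2(K)\ge\dots$ be its singular numbers, i.e. the eigenvalues of $|K|=\sqrt{K^*K}$ counted with multiplicity. For $1\le p<\infty$ let $\mathcal S_p(\mathcal H)$ be the Schatten class of all compact $K$ with $\|K\|_{\mathcal S_p(\mathcal H)}:=\big(\sum_j s_j(K)^p\big)^{1/p}<\infty$. For $m\in\mathbb N=\{1,2,\dots\}$ let $A\mapsto\det_m(1-A)$ be the $m$-regularized determinant, that is, the continuous extension to $\mathcal S_m(\mathcal H)$ of the function $F\mapsto\det(1-F)\exp\big(\sum_{k=1}^{m-1}\frac1k\operatorname{trace}F^k\big)$ on the finite rank operators. **Theorem 2.1.** Let $(\mathcal H_\nu)_{\nu\in\mathbb N_0}$ be a family of complex Hilbert spaces, fix $n_o\in\mathbb N$, and let $G_\nu\in\mathcal S_{n_o}(\mathcal H_\nu)$ satisfy $$\sum_{\nu=0}^\infty\|G_\nu^{n_o}\|_{\mathcal S_1(\mathcal H_\nu)}<\infty .$$ Let $(Z_n)_{n\in\mathbb N}$ be a sequence in $\mathbb C$ such that $Z_n=\sum_{\nu=0}^\infty(-1)^\nu\operatorname{trace}G_\nu^n$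 for all $n\ge n_o$. Then the power series $\sum_{n\ge1}\frac{z^n}{n}Z_n$ has a positive radius of convergence, and the dynamical zeta function $$\zeta_R(z)=\exp\Big(\sum_{n=1}^\infty\frac{z^n}{n}Z_n\Big),$$ defined on the open disc of convergence of this series, admits a meromorphic continuation to all of $\mathbb C$, given by the formula $$\zeta_R(z)=\exp\Big(\sum_{n=1}^{n_o-1}\frac{z^n}{n}Z_n\Big)\prod_{\nu=0}^\infty\Big(\det\nolimits_{n_o}(1-zG_\nu)\Big)^{(-1)^{\nu+1}} =\exp\Big(\sum_{n=1}^{n_o-1}\frac{z^n}{n}Z_n\Big)\frac{\prod_{\nu=0}^\infty\det_{n_o}(1-zG_{2\nu+1})}{\prod_{\nu=0}^\infty\det_{n_o}(1-zG_{2\nu})}$$ for all $z\in U:=\{z\in\mathbb C:\det_{n_o}(1-zG_{2\nu})\ne0\text{ for all }\nu\ge0\}$, where $\mathbb C\setminus U$ is a closed discrete set. Here every $z\mapsto\det_{n_o}(1-zG_\nu)$ is entire, the series $\sum_{\nu}|\det_{n_o}(1-zG_\nu)-1|$ and the products $\prod_\nu\det_{n_o}(1-zG_{2\nu+1})$ and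 $\prod_\nu\det_{n_o}(1-zG_{2\nu})$ converge locally uniformly on $\mathbb C$, and $\prod_\nu\big(\det_{n_o}(1-zG_\nu)\big)^{(-1)^{\nu+1}}$ converges locally uniformly on $U$. -/

import Mathlib

open Filter Topology
open scoped ENNReal InnerProductSpace

noncomputable section

namespace DynZeta

variable {H : Type*} [NormedAddCommGroup H] [InnerProductSpace ℂ H] [CompleteSpace H]

/-- The modulus `|K| = √(K⋆ K)` of a bounded operator. -/
def modulus (K : H →L[ℂ] H) : H →L[ℂ] H := CFC.abs K

/-- The eigenspace of `|K|` for the real number `s`. -/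
def modulusEigenspace (K : H →L[ℂ] H) (s : ℝ) : Submodule ℂ H :=
  Module.End.eigenspace (modulus K : H →ₗ[ℂ] H) (s : ℂ)

/-- The index set of the nonzero singular numbers of a compact operator `K`: every `s > 0` occurs
as often as its multiplicity `dim ker (|K| - s)` as an eigenvalue of `|K|` says. -/
abbrev SingularIndex (K : H →L[ℂ] H) : Type :=
  Σ s : {s : ℝ // 0 < s}, Fin (Module.finrank ℂ (modulusEigenspace K s))

/-- The family of the nonzero singular numbers of `K`, i.e. of the nonzero eigenvalues of `|K|`
counted with multiplicities. -/
def singularNumber (K : H →L[ℂ] H) (i : SingularIndex K) : ℝ := i.1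

open Classical in
/-- The Schatten norm `‖K‖_{S_p}`, the `ℓ^p`-norm of the singular numbers of the compact operator
`K`. It is infinite if `K` is not compact. -/
def schattenNorm (p : ℝ) (K : H →L[ℂ] H) : ℝ≥0∞ :=
  if IsCompactOperator K then
    (∑' i : SingularIndex K, ENNReal.ofReal (singularNumber K i) ^ p) ^ (1 / p)
  else ∞

/-- Membership in the Schatten class `S_p(H)`. -/
def MemSchatten (p : ℝ) (K : H →L[ℂ] H) : Prop := schattenNorm p K < ∞

/-- A Hilbert space basis of `H`. -/
def someHilbertBasis (H : Type*) [NormedAddCommGroup H] [InnerProductSpace ℂ H]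
    [CompleteSpace H] :
    HilbertBasis (exists_hilbertBasis ℂ H).choose ℂ H :=
  (exists_hilbertBasis ℂ H).choose_spec.choose

/-- The trace `∑ᵢ ⟨eᵢ, A eᵢ⟩` of a trace class operator `A`, with respect to an orthonormal basis
(its value does not depend on the basis when `A` is of trace class). -/
def opTrace (A : H →L[ℂ] H) : ℂ :=
  ∑' i, ⟪someHilbertBasis H i, A (someHilbertBasis H i)⟫_ℂ

/-- `F` has finite rank. -/
def IsFiniteRank (F : H →L[ℂ] H) : Prop :=
  FiniteDimensional ℂ (LinearMap.range (F : H →ₗ[ℂ] H))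

/-- `det (1 - F)` for an operator `F` of finite rank: the determinant of the endomorphism that
`1 - F` induces on the range of `F`. -/
def finiteRankDet (F : H →L[ℂ] H) : ℂ :=
  LinearMap.det (LinearMap.id -
    (F : H →ₗ[ℂ] H).restrict (p := LinearMap.range (F : H →ₗ[ℂ] H))
      (q := LinearMap.range (F : H →ₗ[ℂ] H)) (fun x _ => LinearMap.mem_range_self _ x))

/-- The `m`-regularized determinant
`det_m (1 - F) = det (1 - F) exp (∑_{k=1}^{m-1} trace (F ^ k) / k)` for `F` of finite rank. -/
def finiteRankRegDet (m : ℕ) (F : H →L[ℂ] H) : ℂ :=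
  finiteRankDet F * Complex.exp (∑ k ∈ Finset.Ico 1 m, (1 / (k : ℂ)) * opTrace (F ^ k))

/-- The filter of the finite rank operators `F` that converge to `A` in the Schatten norm, i.e.
`‖F - A‖_{S_p} → 0`. -/
def finiteRankNhds (p : ℝ) (A : H →L[ℂ] H) : Filter (H →L[ℂ] H) :=
  comap (fun F => schattenNorm p (F - A)) (𝓝 0) ⊓ 𝓟 {F | IsFiniteRank F}

/-- The `m`-regularized determinant `det_m (1 - A)` for `A ∈ S_m(H)`: the value at `A` of the
extension by `S_m`-continuity of `F ↦ det_m (1 - F)` from the finite rank operators. -/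
def regDet (m : ℕ) (A : H →L[ℂ] H) : ℂ :=
  limUnder (finiteRankNhds m A) (finiteRankRegDet m)

/-- The `n`-th term `z ^ (n + 1) / (n + 1) * Z (n + 1)` (shifted to start at `n = 0`) of the power
series in the exponent of the dynamical zeta function of `Z 1, Z 2, …`. -/
def zetaTerm (Z : ℕ → ℂ) (z : ℂ) (n : ℕ) : ℂ := z ^ (n + 1) / ((n : ℂ) + 1) * Z (n + 1)

/-- The dynamical zeta function `ζ_R(z) = exp (∑_{n ≥ 1} z ^ n / n * Z n)`. -/
def dynZeta (Z : ℕ → ℂ) (z : ℂ) : ℂ := Complex.exp (∑' n, zetaTerm Z z n)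

end DynZeta

end

noncomputable section
set_option linter.unusedSectionVars false

namespace DynZeta
variable {H : Type*} [NormedAddCommGroup H] [InnerProductSpace ℂ H] [CompleteSpace H]

/-! The main point is to control $\det_m(1-zA)$ by the trace norm $T$ of $A^m$ alone, since
$\|A^m\|_1$ is what is summable over the family; neither the $\mathcal S_m$ norms nor the operator
norms of the $G_\nu$ are assumed bounded.

For $F$ of finite rank, a Schur triangulation on the range gives $\det_m(1-wF)=\prod_j E_m(w\mu_j)$
with Weierstrass primary factors $E_m$. The numbers $\mu_j^m$ are diagonal entries of $F^m$ in an
orthonormal family, so $\sum_j|\mu_j|^m\le\|F^m\|_1$. As $E_m(u)-1=O(|u|^m)$, this bounds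
$|\det_m(1-wF)-1|$ on every disc in terms of $T$ (`IsFiniteRank.detSeries_bounds`). Moreover
$f(w)=\det_m(1-wF)$ solves $f'=-Qf$, $f(0)=1$, with $Q(w)=\sum_{n\ge
m}\operatorname{trace}(F^n)w^{n-1}$ near $0$. Hence its Taylor coefficients are universal
polynomials in the traces of $F^n$ with $n\ge m$.

These traces are continuous in the $\mathcal S_m$ norm by Hölder's inequality for $m$ factors
(`schattenNorm_one_list_prod_le`, `tendsto_opTrace_pow`). Cauchy's estimates dominate the Taylor
series, so everything passes to the limit $F\to A$: the extended determinant exists, is entire in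
$z$, obeys the same bounds, and near $0$ equals $\exp(-\sum_{n\ge
m}\operatorname{trace}(A^n)z^n/n)$.

With $T_\nu$ summable, the determinants minus $1$ are summably dominated on discs, so the products
over even and odd $\nu$ are entire functions $E$ and $O$. Near $0$ an absolutely convergent double
series may be rearranged, giving $\zeta_R E=e^{\text{polynomial}}\,O$. The identity theorem extends
this to any disc on which the zeta series converges, and the quotient is the continuation. -/

/-- A singular value decomposition `B = ∑ σᵢ ⟨vᵢ, ·⟩ uᵢ`, in weak form. -/
structure IsSVD {ι : Type*} (B : H →L[ℂ] H) (σ : ι → ℝ) (u v : ι → H) : Prop where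
  nonneg : ∀ i, 0 ≤ σ i
  orthonormal_left : Orthonormal ℂ u
  orthonormal_right : Orthonormal ℂ v
  hasSum : ∀ x y, HasSum (fun i => (σ i : ℂ) * ⟪v i, x⟫_ℂ * ⟪y, u i⟫_ℂ) ⟪y, B x⟫_ℂ

/-! ### Singular value decomposition of a compact operator -/

section Singular

variable {K : H →L[ℂ] H}

theorem modulus_isPositive (K : H →L[ℂ] H) : (modulus K).IsPositive :=
  (ContinuousLinearMap.nonneg_iff_isPositive _).1 (CFC.abs_nonneg K)

theorem modulus_modulus (K : H →L[ℂ] H) (x : H) :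
    modulus K (modulus K x) = K.adjoint (K x) :=
  congrArg (fun T : H →L[ℂ] H => T x) (CFC.abs_mul_abs K)

theorem mem_modulusEigenspace {s : ℝ} {x : H} :
    x ∈ modulusEigenspace K s ↔ modulus K x = (s : ℂ) • x :=
  Module.End.mem_eigenspace_iff

/-- Trades the square root for $K^*K$, to which the spectral theorem is applied. For the converse,
$d=|K|x-sx$ satisfies $|K|d=-sd$, which positivity of $|K|$ allows only for $d=0$. -/
theorem mem_modulusEigenspace_iff {s : ℝ} (hs : 0 < s) {x : H} :
    x ∈ modulusEigenspace K s ↔ K.adjoint (K x) = ((s : ℂ) ^ 2) • x := by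
  rw [mem_modulusEigenspace, ← modulus_modulus]
  constructor
  · intro h
    rw [h, map_smul, h, smul_smul, sq]
  · intro h
    set d := modulus K x - (s : ℂ) • x with hd
    have h1 : modulus K d = -((s : ℂ) • d) := by
      rw [hd, map_sub, h, map_smul, smul_sub, smul_smul, sq]
      abel
    have h2 := (modulus_isPositive K).re_inner_nonneg_right d
    rw [h1, inner_neg_right, inner_smul_right, inner_self_eq_norm_sq_to_K] at h2
    have h3 : 0 ≤ -(s * ‖d‖ ^ 2) := by
      convert h2 using 1
      simp only [map_neg, RCLike.re_to_complex, Complex.re_ofReal_mul]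
      norm_cast
    have h4 : ‖d‖ ^ 2 = 0 := by
      nlinarith [sq_nonneg ‖d‖, mul_nonneg hs.le (sq_nonneg ‖d‖)]
    have : d = 0 := by simpa using h4
    exact sub_eq_zero.1 this

theorem adjoint_comp_self_isCompact (hK : IsCompactOperator K) :
    IsCompactOperator (K.adjoint ∘L K) := hK.clm_comp K.adjoint

theorem adjoint_comp_self_isSymmetric (K : H →L[ℂ] H) :
    ((K.adjoint ∘L K : H →L[ℂ] H) : H →ₗ[ℂ] H).IsSymmetric := by
  intro x y
  simp [ContinuousLinearMap.adjoint_inner_left, ContinuousLinearMap.adjoint_inner_right]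

theorem finiteDimensional_modulusEigenspace (hK : IsCompactOperator K) {s : ℝ} (hs : 0 < s) :
    FiniteDimensional ℂ (modulusEigenspace K s) := by
  have := ContinuousLinearMap.finite_dimensional_eigenspace (adjoint_comp_self_isCompact hK)
    ((s : ℂ) ^ 2) (by simpa using hs.ne')
  have heq : modulusEigenspace K s =
      Module.End.eigenspace ((K.adjoint ∘L K : H →L[ℂ] H) : Module.End ℂ H) ((s : ℂ) ^ 2) := by
    ext x
    rw [mem_modulusEigenspace_iff hs, Module.End.mem_eigenspace_iff]
    rfl
  rw [heq]
  exact this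

open Classical in
/-- The right singular vectors of a compact operator. -/
def rightVec (K : H →L[ℂ] H) (i : SingularIndex K) : H :=
  if _h : FiniteDimensional ℂ (modulusEigenspace K i.1) then
    (stdOrthonormalBasis ℂ (modulusEigenspace K i.1) i.2 : H)
  else 0

/-- The left singular vectors of a compact operator. -/
def leftVec (K : H →L[ℂ] H) (i : SingularIndex K) : H :=
  ((singularNumber K i : ℂ)⁻¹) • K (rightVec K i)

theorem singularNumber_pos (i : SingularIndex K) : 0 < singularNumber K i := i.1.2

theorem rightVec_mem (i : SingularIndex K) : rightVec K i ∈ modulusEigenspace K i.1 := by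
  unfold rightVec
  split_ifs
  · exact Subtype.prop _
  · exact zero_mem _

theorem orthonormal_rightVec (hK : IsCompactOperator K) : Orthonormal ℂ (rightVec K) := by
  have hf : ∀ s : {s : ℝ // 0 < s}, FiniteDimensional ℂ (modulusEigenspace K s) :=
    fun s => finiteDimensional_modulusEigenspace hK s.2
  have hsym := (modulus_isPositive K).isSymmetric
  have := hsym.orthogonalFamily_eigenspaces.comp
    (γ := {s : ℝ // 0 < s}) (f := fun s => ((s : ℝ) : ℂ))
    (fun a b h => Subtype.ext (Complex.ofReal_injective h))
  have h2 := this.orthonormal_sigma_orthonormal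
    (v_family := fun s => stdOrthonormalBasis ℂ (modulusEigenspace K s))
    (fun s => (stdOrthonormalBasis ℂ (modulusEigenspace K s)).orthonormal)
  convert! h2 using 1
  ext i
  simp [rightVec, hf i.1]

theorem adjoint_apply_rightVec (i : SingularIndex K) :
    K.adjoint (K (rightVec K i)) = ((singularNumber K i : ℂ) ^ 2) • rightVec K i :=
  (mem_modulusEigenspace_iff i.1.2).1 (rightVec_mem i)

theorem orthonormal_leftVec (hK : IsCompactOperator K) : Orthonormal ℂ (leftVec K) := by
  classical
  have h := orthonormal_rightVec hK
  rw [orthonormal_iff_ite] at h ⊢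
  intro i j
  have hi : (singularNumber K i : ℂ) ≠ 0 := by exact_mod_cast (singularNumber_pos i).ne'
  have hj : (singularNumber K j : ℂ) ≠ 0 := by exact_mod_cast (singularNumber_pos j).ne'
  rw [leftVec, leftVec, inner_smul_left, inner_smul_right, ← ContinuousLinearMap.adjoint_inner_right,
    adjoint_apply_rightVec, inner_smul_right, h i j]
  split_ifs with hij
  · subst hij
    simp only [map_inv₀, Complex.conj_ofReal]
    field_simp
  · simp

/-- Subtract from $y$ its projection $y_0$ to $\ker K$. The difference is orthogonal to every
eigenspace of $K^*K$: to the kernel by construction, to the others because both $y$ and $y_0$ are.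
These eigenspaces span a dense subspace, so $y=y_0$. -/
theorem apply_eq_zero_of_forall_inner_rightVec (hK : IsCompactOperator K) {y : H}
    (hy : ∀ i, ⟪rightVec K i, y⟫_ℂ = 0) : K y = 0 := by
  set T : H →L[ℂ] H := K.adjoint ∘L K with hT
  have hTs := adjoint_comp_self_isSymmetric K
  have hbot := ContinuousLinearMap.orthogonalComplement_iSup_eigenspaces_eq_bot
    (adjoint_comp_self_isCompact hK) hTs
  set N : Submodule ℂ H := LinearMap.ker (K : H →ₗ[ℂ] H) with hN
  have hNc : IsClosed (N : Set H) := K.isClosed_ker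
  have : CompleteSpace N := hNc.completeSpace_coe
  set y0 : H := N.starProjection y with hy0
  have hy0N : y0 ∈ N := Submodule.starProjection_apply_mem N y
  have hy1 : y - y0 ∈ Nᗮ := N.sub_starProjection_mem_orthogonal y
  have hmem : y - y0 ∈ (⨆ μ, Module.End.eigenspace (T : Module.End ℂ H) μ)ᗮ := by
    rw [← Submodule.iInf_orthogonal, Submodule.mem_iInf]
    intro μ
    rw [Submodule.mem_orthogonal]
    intro w hw
    rw [Module.End.mem_eigenspace_iff] at hw
    have hw' : K.adjoint (K w) = μ • w := hw
    by_cases hKw : K w = 0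
    · exact hy1 w hKw
    have hw0 : w ≠ 0 := by rintro rfl; simp at hKw
    have hμ : μ * (‖w‖ : ℂ) ^ 2 = (‖K w‖ : ℂ) ^ 2 := by
      have := ContinuousLinearMap.adjoint_inner_right K w (K w)
      rw [hw', inner_smul_right, inner_self_eq_norm_sq_to_K, inner_self_eq_norm_sq_to_K] at this
      exact this
    -- The eigenvalue $\mu$ is the square of this number, so $w$ is an eigenvector of $|K|$ for $s$.
    set s : ℝ := ‖K w‖ / ‖w‖ with hs
    have hwn : 0 < ‖w‖ := norm_pos_iff.2 hw0
    have hspos : 0 < s := div_pos (norm_pos_iff.2 hKw) hwn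
    have hμs : μ = (s : ℂ) ^ 2 := by
      have : (‖w‖ : ℂ) ≠ 0 := by exact_mod_cast hwn.ne'
      rw [hs]; push_cast; field_simp; exact hμ
    have hws : w ∈ modulusEigenspace K s := (mem_modulusEigenspace_iff hspos).2 (hμs ▸ hw')
    have hfd := finiteDimensional_modulusEigenspace hK hspos
    have h1 : ⟪w, y⟫_ℂ = 0 := by
      have := (stdOrthonormalBasis ℂ (modulusEigenspace K s)).sum_repr ⟨w, hws⟩
      have h3 := congrArg Subtype.val this
      simp only [Submodule.coe_sum, Submodule.coe_smul] at h3
      rw [← h3, sum_inner]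
      refine Finset.sum_eq_zero fun i _ => ?_
      have h4 := hy ⟨⟨s, hspos⟩, i⟩
      rw [rightVec, dif_pos hfd] at h4
      rw [inner_smul_left, h4, mul_zero]
    have h2 : ⟪w, y0⟫_ℂ = 0 := by
      have hy0' : K y0 = 0 := hy0N
      have h3 := ContinuousLinearMap.adjoint_inner_left K y0 (K w)
      rw [hy0', inner_zero_right, hw', inner_smul_left] at h3
      have : (starRingEnd ℂ) μ ≠ 0 := by
        rw [hμs]; simpa using hspos.ne'
      exact (mul_eq_zero.1 h3).resolve_left this
    rw [inner_sub_right, h1, h2, sub_zero]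
  rw [hbot, Submodule.mem_bot, sub_eq_zero] at hmem
  rw [hmem]
  exact hy0N

theorem isSVD_of_isCompactOperator (hK : IsCompactOperator K) :
    IsSVD K (singularNumber K) (leftVec K) (rightVec K) := by
  have hv := orthonormal_rightVec hK
  refine ⟨fun i => (singularNumber_pos i).le, orthonormal_leftVec hK, hv, fun x y => ?_⟩
  -- Parseval in a basis extending the right singular vectors; the added basis vectors lie in $\ker
  -- K$ and contribute nothing.
  obtain ⟨w, b, hw, hb⟩ := hv.toSubtypeRange.exists_hilbertBasis_extension
  let g : SingularIndex K → w := fun i => ⟨rightVec K i, hw ⟨i, rfl⟩⟩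
  have hg : Function.Injective g := fun i j h => hv.linearIndependent.injective
    (congrArg Subtype.val h)
  have h1 := b.hasSum_inner_mul_inner (K.adjoint y) x
  rw [ContinuousLinearMap.adjoint_inner_left] at h1
  rw [← hg.hasSum_iff] at h1
  · convert! h1 using 1
    ext i
    have hi : (singularNumber K i : ℂ) ≠ 0 := by exact_mod_cast (singularNumber_pos i).ne'
    simp only [Function.comp_apply, hb, g, ContinuousLinearMap.adjoint_inner_left, leftVec,
      inner_smul_right]
    field_simp
  · intro j hj
    have : K (b j) = 0 := by
      refine apply_eq_zero_of_forall_inner_rightVec hK fun i => ?_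
      have hne : g i ≠ j := fun h => hj ⟨i, h⟩
      have := b.orthonormal.2 hne
      rw [hb] at this
      simpa [hb] using this
    rw [ContinuousLinearMap.adjoint_inner_left, this, inner_zero_right, zero_mul]

end Singular

/-! ### Hölder, Minkowski and Jensen inequalities for sums -/

section ENNRealSums

theorem tsum_mul_rpow_le {ι : Type*} (a b : ι → ℝ≥0∞) {p q r : ℝ} (hr : 0 < r) (hrp : r < p)
    (h : 1 / r = 1 / p + 1 / q) :
    (∑' i, (a i * b i) ^ r) ^ (1 / r) ≤
      (∑' i, a i ^ p) ^ (1 / p) * (∑' i, b i ^ q) ^ (1 / q) := by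
  let _ : MeasurableSpace ι := ⊤
  have := ENNReal.lintegral_Lp_mul_le_Lq_mul_Lr hr hrp h MeasureTheory.Measure.count
    (f := a) (g := b) measurable_from_top.aemeasurable measurable_from_top.aemeasurable
  simpa only [MeasureTheory.lintegral_count, Pi.mul_apply] using this

theorem tsum_mul_le {ι : Type*} (a b : ι → ℝ≥0∞) {p q : ℝ} (hp : 1 < p)
    (h : 1 = 1 / p + 1 / q) :
    ∑' i, a i * b i ≤ (∑' i, a i ^ p) ^ (1 / p) * (∑' i, b i ^ q) ^ (1 / q) := by
  simpa using tsum_mul_rpow_le a b one_pos hp (by simpa using h)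

theorem tsum_add_rpow_le {ι : Type*} (a b : ι → ℝ≥0∞) {p : ℝ} (hp : 1 ≤ p) :
    (∑' i, (a i + b i) ^ p) ^ (1 / p) ≤ (∑' i, a i ^ p) ^ (1 / p) + (∑' i, b i ^ p) ^ (1 / p) := by
  let _ : MeasurableSpace ι := ⊤
  have := ENNReal.lintegral_Lp_add_le (μ := MeasureTheory.Measure.count)
    (f := a) (g := b) measurable_from_top.aemeasurable measurable_from_top.aemeasurable hp
  simpa only [MeasureTheory.lintegral_count, Pi.add_apply] using this

theorem tsum_weight_mul_mul_le {ι : Type*} (w a b : ι → ℝ≥0∞) :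
    ∑' i, w i * (a i * b i) ≤
      (∑' i, w i * a i ^ 2) ^ (1 / 2 : ℝ) * (∑' i, w i * b i ^ 2) ^ (1 / 2 : ℝ) := by
  have h := tsum_mul_le (fun i => w i ^ (1 / 2 : ℝ) * a i) (fun i => w i ^ (1 / 2 : ℝ) * b i)
    (p := 2) (q := 2) (by norm_num) (by norm_num)
  have hw : ∀ i, w i ^ (1 / 2 : ℝ) * w i ^ (1 / 2 : ℝ) = w i := fun i => by
    rw [← ENNReal.rpow_add_of_nonneg _ _ (by norm_num) (by norm_num)]
    norm_num
  have hs : ∀ (c : ι → ℝ≥0∞) i, (w i ^ (1 / 2 : ℝ) * c i) ^ (2 : ℝ) = w i * c i ^ 2 := by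
    intro c i
    rw [ENNReal.rpow_two, mul_pow, sq (w i ^ (1 / 2 : ℝ)), hw]
  simp only [hs] at h
  convert! h using 3 with i
  rw [mul_mul_mul_comm, hw]

/-- Jensen's inequality for weights of total mass at most one: Hölder produces the factor $(\sum
w)^{1-1/q}\le1$. -/
theorem tsum_mul_le_of_tsum_le_one {ι : Type*} (w a : ι → ℝ≥0∞) {q : ℝ} (hq : 1 ≤ q)
    (hw : ∑' i, w i ≤ 1) : (∑' i, a i * w i) ^ q ≤ ∑' i, a i ^ q * w i := by
  have hq0 : 0 < q := zero_lt_one.trans_le hq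
  have h : ∑' i, a i * w i ≤ (∑' i, a i ^ q * w i) ^ q⁻¹ := by
    rw [ENNReal.tsum_eq_iSup_sum]
    refine iSup_le fun s => ?_
    simp only [mul_comm _ (w _)]
    refine (ENNReal.inner_le_weight_mul_Lp_of_nonneg s hq w a).trans ?_
    calc (∑ i ∈ s, w i) ^ (1 - q⁻¹) * (∑ i ∈ s, w i * a i ^ q) ^ q⁻¹
        ≤ 1 * (∑' i, w i * a i ^ q) ^ q⁻¹ := by
          gcongr
          · exact ENNReal.rpow_le_one ((ENNReal.sum_le_tsum s).trans hw)
              (sub_nonneg.2 (inv_le_one_of_one_le₀ hq))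
          · exact ENNReal.sum_le_tsum s
      _ = _ := one_mul _
  calc (∑' i, a i * w i) ^ q ≤ ((∑' i, a i ^ q * w i) ^ q⁻¹) ^ q := by gcongr
    _ = _ := by rw [← ENNReal.rpow_mul, inv_mul_cancel₀ hq0.ne', ENNReal.rpow_one]

/-- Doubly substochastic kernels contract the `ℓ^q` norm. -/
theorem tsum_rpow_tsum_mul_le {ι κ : Type*} (D : κ → ι → ℝ≥0∞) (a : ι → ℝ≥0∞) {q : ℝ} (hq : 1 ≤ q)
    (hrow : ∀ j, ∑' i, D j i ≤ 1) (hcol : ∀ i, ∑' j, D j i ≤ 1) :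
    ∑' j, (∑' i, a i * D j i) ^ q ≤ ∑' i, a i ^ q := by
  calc ∑' j, (∑' i, a i * D j i) ^ q ≤ ∑' j, ∑' i, a i ^ q * D j i :=
        ENNReal.tsum_le_tsum fun j => tsum_mul_le_of_tsum_le_one _ _ hq (hrow j)
    _ = ∑' i, a i ^ q * ∑' j, D j i := by
        rw [ENNReal.tsum_comm]
        simp only [ENNReal.tsum_mul_left]
    _ ≤ ∑' i, a i ^ q := ENNReal.tsum_le_tsum fun i => mul_le_of_le_one_right' (hcol i)

theorem coe_mul_coe_le_half_sq_add_sq (a b : NNReal) :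
    (a : ℝ≥0∞) * b ≤ ((a : ℝ≥0∞) ^ 2 + (b : ℝ≥0∞) ^ 2) / 2 := by
  rw [ENNReal.le_div_iff_mul_le (by simp) (by simp)]
  norm_cast
  have := two_mul_le_add_sq a b
  calc a * b * 2 = 2 * a * b := by ring
    _ ≤ _ := this

end ENNRealSums

/-! ### Testing a singular value decomposition on orthonormal families -/

theorem tsum_enorm_inner_sq_le {ι : Type*} {v : ι → H} (hv : Orthonormal ℂ v) (x : H) :
    ∑' i, ‖⟪v i, x⟫_ℂ‖ₑ ^ 2 ≤ ‖x‖ₑ ^ 2 := by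
  rw [ENNReal.tsum_eq_iSup_sum]
  refine iSup_le fun s => ?_
  have h := hv.sum_inner_products_le x (s := s)
  simp only [enorm_eq_nnnorm]
  norm_cast
  rw [← NNReal.coe_le_coe]
  push_cast
  exact h

theorem tsum_enorm_inner_sq_le' {ι : Type*} {v : ι → H} (hv : Orthonormal ℂ v) (x : H) :
    ∑' i, ‖⟪x, v i⟫_ℂ‖ₑ ^ 2 ≤ ‖x‖ₑ ^ 2 := by
  refine le_trans (le_of_eq ?_) (tsum_enorm_inner_sq_le hv x)
  refine tsum_congr fun i => ?_
  rw [← ofReal_norm, ← ofReal_norm, norm_inner_symm]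

namespace IsSVD

variable {ι κ : Type*} {B : H →L[ℂ] H} {σ : ι → ℝ} {u v : ι → H}

theorem enorm_inner_le (h : IsSVD B σ u v) (x y : H) :
    ‖⟪y, B x⟫_ℂ‖ₑ ≤ ∑' i, ENNReal.ofReal (σ i) * (‖⟪v i, x⟫_ℂ‖ₑ * ‖⟪y, u i⟫_ℂ‖ₑ) := by
  rw [← (h.hasSum x y).tsum_eq]
  refine enorm_tsum_le_tsum_enorm.trans (le_of_eq (tsum_congr fun i => ?_))
  rw [enorm_mul, enorm_mul, mul_assoc, ← ofReal_norm (σ i : ℂ), Complex.norm_real,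
    Real.norm_of_nonneg (h.nonneg i)]

theorem adjoint (h : IsSVD B σ u v) : IsSVD B.adjoint σ v u := by
  refine ⟨h.nonneg, h.orthonormal_right, h.orthonormal_left, fun x y => ?_⟩
  have := (h.hasSum y x).star
  simp only [RCLike.star_def, map_mul, Complex.conj_ofReal, inner_conj_symm] at this
  rw [ContinuousLinearMap.adjoint_inner_right]
  convert! this using 1
  ext i
  ring

theorem inner_left_apply (h : IsSVD B σ u v) (i : ι) (x : H) :
    ⟪u i, B x⟫_ℂ = σ i * ⟪v i, x⟫_ℂ := by
  classical
  have h1 := h.hasSum x (u i)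
  have h2 := hasSum_single (f := fun j => (σ j : ℂ) * ⟪v j, x⟫_ℂ * ⟪u i, u j⟫_ℂ) i (by
    intro j hj
    rw [h.orthonormal_left.2 hj.symm, mul_zero])
  rw [h1.unique h2, inner_self_eq_norm_sq_to_K, h.orthonormal_left.1 i]
  simp

theorem inner_left_apply_right (h : IsSVD B σ u v) (i : ι) : ⟪u i, B (v i)⟫_ℂ = σ i := by
  rw [h.inner_left_apply, inner_self_eq_norm_sq_to_K, h.orthonormal_right.1 i]
  simp

theorem enorm_apply_sq_le (h : IsSVD B σ u v) (x : H) :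
    ‖B x‖ₑ ^ 2 ≤ ∑' i, ENNReal.ofReal (σ i) ^ 2 * ‖⟪v i, x⟫_ℂ‖ₑ ^ 2 := by
  have h1 := h.enorm_inner_le x (B x)
  have h2 : ‖⟪B x, B x⟫_ℂ‖ₑ = ‖B x‖ₑ ^ 2 := by
    rw [inner_self_eq_norm_sq_to_K, enorm_pow]
    congr 1
    rw [← ofReal_norm, ← ofReal_norm]
    simp
  rw [h2] at h1
  refine h1.trans (le_of_eq (tsum_congr fun i => ?_))
  have h3 : ‖⟪B x, u i⟫_ℂ‖ₑ = ENNReal.ofReal (σ i) * ‖⟪v i, x⟫_ℂ‖ₑ := by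
    rw [← ofReal_norm, norm_inner_symm, h.inner_left_apply, norm_mul, Complex.norm_real,
      Real.norm_of_nonneg (h.nonneg i), ENNReal.ofReal_mul (h.nonneg i), ofReal_norm]
  rw [h3]
  ring

/-- By the arithmetic-geometric mean inequality the matrix entries are dominated by the kernel
$\frac12(|\langle v_i,e_j\rangle|^2+|\langle f_j,u_i\rangle|^2)$ applied to $\sigma$; Bessel's
inequality makes this kernel doubly substochastic. -/
theorem tsum_enorm_inner_rpow_le (h : IsSVD B σ u v) {e f : κ → H} (he : Orthonormal ℂ e)
    (hf : Orthonormal ℂ f) {p : ℝ} (hp : 1 ≤ p) :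
    ∑' j, ‖⟪f j, B (e j)⟫_ℂ‖ₑ ^ p ≤ ∑' i, ENNReal.ofReal (σ i) ^ p := by
  refine le_trans (ENNReal.tsum_le_tsum fun j => ?_)
    (tsum_rpow_tsum_mul_le (fun j i => (‖⟪v i, e j⟫_ℂ‖ₑ ^ 2 + ‖⟪f j, u i⟫_ℂ‖ₑ ^ 2) / 2)
      (fun i => ENNReal.ofReal (σ i)) hp (fun j => ?_) (fun i => ?_))
  · refine ENNReal.rpow_le_rpow ((h.enorm_inner_le _ _).trans ?_) (by linarith)
    exact ENNReal.tsum_le_tsum fun i => by gcongr; exact coe_mul_coe_le_half_sq_add_sq _ _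
  · simp only [ENNReal.div_eq_inv_mul, ENNReal.tsum_mul_left, ENNReal.tsum_add]
    have h1 := tsum_enorm_inner_sq_le h.orthonormal_right (e j)
    have h2 := tsum_enorm_inner_sq_le' h.orthonormal_left (f j)
    rw [he.enorm_eq_one] at h1
    rw [hf.enorm_eq_one] at h2
    rw [← ENNReal.div_eq_inv_mul, ENNReal.div_le_iff (by simp) (by simp)]
    refine (add_le_add h1 h2).trans ?_
    norm_num
  · simp only [ENNReal.div_eq_inv_mul, ENNReal.tsum_mul_left, ENNReal.tsum_add]
    have h1 := tsum_enorm_inner_sq_le' he (v i)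
    have h2 := tsum_enorm_inner_sq_le hf (u i)
    rw [h.orthonormal_right.enorm_eq_one] at h1
    rw [h.orthonormal_left.enorm_eq_one] at h2
    rw [← ENNReal.div_eq_inv_mul, ENNReal.div_le_iff (by simp) (by simp)]
    refine (add_le_add h1 h2).trans ?_
    norm_num

/-- The kernel $|\langle v_i,e_j\rangle|^2$ acts on $\sigma_i^2$ here, and its contraction property
is used with exponent $p/2$; hence the restriction $p\ge2$. -/
theorem tsum_enorm_apply_rpow_le (h : IsSVD B σ u v) {e : κ → H} (he : Orthonormal ℂ e)
    {p : ℝ} (hp : 2 ≤ p) :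
    ∑' j, ‖B (e j)‖ₑ ^ p ≤ ∑' i, ENNReal.ofReal (σ i) ^ p := by
  have h1 := tsum_rpow_tsum_mul_le (fun j i => ‖⟪v i, e j⟫_ℂ‖ₑ ^ 2)
      (fun i => ENNReal.ofReal (σ i) ^ 2) (q := p / 2) (by linarith) (fun j => ?_) (fun i => ?_)
  · have h2 : ∀ x : ℝ≥0∞, (x ^ 2) ^ (p / 2) = x ^ p := fun x => by
      rw [← ENNReal.rpow_two, ← ENNReal.rpow_mul]
      congr 1
      ring
    simp only [h2] at h1
    refine le_trans (ENNReal.tsum_le_tsum fun j => ?_) h1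
    rw [← h2]
    exact ENNReal.rpow_le_rpow (h.enorm_apply_sq_le _) (by linarith)
  · simpa [he.enorm_eq_one] using tsum_enorm_inner_sq_le h.orthonormal_right (e j)
  · simpa [h.orthonormal_right.enorm_eq_one] using tsum_enorm_inner_sq_le' he (v i)

end IsSVD

/-! ### Variational description of the Schatten norm and its inequalities -/

section Schatten

variable {κ : Type*} {A B K : H →L[ℂ] H} {p : ℝ}

theorem schattenNorm_of_isCompactOperator (hK : IsCompactOperator K) :
    schattenNorm p K =
      (∑' i : SingularIndex K, ENNReal.ofReal (singularNumber K i) ^ p) ^ (1 / p) := by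
  rw [schattenNorm, if_pos hK]

theorem MemSchatten.isCompactOperator (h : MemSchatten p K) : IsCompactOperator K := by
  by_contra hK
  rw [MemSchatten, schattenNorm, if_neg hK] at h
  exact lt_irrefl _ h

/-- The singular vectors attain the bound `tsum_enorm_inner_rpow_le_schattenNorm`, so the Schatten
norm is a maximum over pairs of orthonormal families. The norm inequalities below test an operator
on its own singular vectors and then use this maximality for the summands or factors. -/
theorem schattenNorm_eq_tsum_inner (hK : IsCompactOperator K) :
    schattenNorm p K =
      (∑' i : SingularIndex K, ‖⟪leftVec K i, K (rightVec K i)⟫_ℂ‖ₑ ^ p) ^ (1 / p) := by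
  have h := isSVD_of_isCompactOperator hK
  rw [schattenNorm_of_isCompactOperator hK]
  congr 1
  refine tsum_congr fun i => ?_
  rw [h.inner_left_apply_right, ← ofReal_norm, Complex.norm_real, Real.norm_of_nonneg (h.nonneg i)]

theorem tsum_enorm_inner_rpow_le_schattenNorm (K : H →L[ℂ] H) {e f : κ → H} (he : Orthonormal ℂ e)
    (hf : Orthonormal ℂ f) (hp : 1 ≤ p) :
    (∑' j, ‖⟪f j, K (e j)⟫_ℂ‖ₑ ^ p) ^ (1 / p) ≤ schattenNorm p K := by
  by_cases hK : IsCompactOperator K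
  · rw [schattenNorm_of_isCompactOperator hK]
    exact ENNReal.rpow_le_rpow ((isSVD_of_isCompactOperator hK).tsum_enorm_inner_rpow_le he hf hp)
      (by positivity)
  · rw [schattenNorm, if_neg hK]
    exact le_top

theorem tsum_enorm_inner_le_schattenNorm (K : H →L[ℂ] H) {e f : κ → H} (he : Orthonormal ℂ e)
    (hf : Orthonormal ℂ f) : ∑' j, ‖⟪f j, K (e j)⟫_ℂ‖ₑ ≤ schattenNorm 1 K := by
  simpa using tsum_enorm_inner_rpow_le_schattenNorm K he hf le_rfl

theorem tsum_enorm_apply_rpow_le_schattenNorm (K : H →L[ℂ] H) {e : κ → H} (he : Orthonormal ℂ e)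
    (hp : 2 ≤ p) : (∑' j, ‖K (e j)‖ₑ ^ p) ^ (1 / p) ≤ schattenNorm p K := by
  by_cases hK : IsCompactOperator K
  · rw [schattenNorm_of_isCompactOperator hK]
    exact ENNReal.rpow_le_rpow ((isSVD_of_isCompactOperator hK).tsum_enorm_apply_rpow_le he hp)
      (by positivity)
  · rw [schattenNorm, if_neg hK]
    exact le_top

theorem tsum_enorm_adjoint_apply_rpow_le_schattenNorm (K : H →L[ℂ] H) {e : κ → H}
    (he : Orthonormal ℂ e) (hp : 2 ≤ p) :
    (∑' j, ‖K.adjoint (e j)‖ₑ ^ p) ^ (1 / p) ≤ schattenNorm p K := by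
  by_cases hK : IsCompactOperator K
  · rw [schattenNorm_of_isCompactOperator hK]
    exact ENNReal.rpow_le_rpow
      ((isSVD_of_isCompactOperator hK).adjoint.tsum_enorm_apply_rpow_le he hp) (by positivity)
  · rw [schattenNorm, if_neg hK]
    exact le_top

theorem IsSVD.schattenNorm_le {ι : Type*} {σ : ι → ℝ} {u v : ι → H} (h : IsSVD K σ u v)
    (hK : IsCompactOperator K) (hp : 1 ≤ p) :
    schattenNorm p K ≤ (∑' i, ENNReal.ofReal (σ i) ^ p) ^ (1 / p) := by
  have h' := isSVD_of_isCompactOperator hK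
  rw [schattenNorm_eq_tsum_inner hK]
  exact ENNReal.rpow_le_rpow (h.tsum_enorm_inner_rpow_le h'.orthonormal_right h'.orthonormal_left hp)
    (by positivity)

theorem schattenNorm_add_le (hA : IsCompactOperator A) (hB : IsCompactOperator B) (hp : 1 ≤ p) :
    schattenNorm p (A + B) ≤ schattenNorm p A + schattenNorm p B := by
  have hAB : IsCompactOperator (A + B) := hA.add hB
  have h' := isSVD_of_isCompactOperator hAB
  rw [schattenNorm_eq_tsum_inner hAB]
  refine le_trans ?_ (add_le_add
    (tsum_enorm_inner_rpow_le_schattenNorm A h'.orthonormal_right h'.orthonormal_left hp)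
    (tsum_enorm_inner_rpow_le_schattenNorm B h'.orthonormal_right h'.orthonormal_left hp))
  refine le_trans ?_ (tsum_add_rpow_le _ _ hp)
  refine ENNReal.rpow_le_rpow (ENNReal.tsum_le_tsum fun i => ?_) (by positivity)
  refine ENNReal.rpow_le_rpow ?_ (by linarith)
  rw [add_apply, inner_add_right]
  exact enorm_add_le _ _

theorem schattenNorm_smul_le (hA : IsCompactOperator A) (c : ℂ) (hp : 1 ≤ p) :
    schattenNorm p (c • A) ≤ ‖c‖ₑ * schattenNorm p A := by
  have hp0 : 0 < p := by linarith
  have hcA : IsCompactOperator (c • A) := hA.smul c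
  have h' := isSVD_of_isCompactOperator hcA
  rw [schattenNorm_eq_tsum_inner hcA]
  refine le_trans (le_of_eq ?_) (mul_le_mul_right
    (tsum_enorm_inner_rpow_le_schattenNorm A h'.orthonormal_right h'.orthonormal_left hp) _)
  simp only [smul_apply, inner_smul_right, enorm_mul,
    ENNReal.mul_rpow_of_nonneg _ _ hp0.le, ENNReal.tsum_mul_left]
  rw [ENNReal.mul_rpow_of_nonneg _ _ (by positivity), ← ENNReal.rpow_mul,
    mul_one_div_cancel hp0.ne', ENNReal.rpow_one]

theorem MemSchatten.smul (hA : MemSchatten p A) (c : ℂ) (hp : 1 ≤ p) : MemSchatten p (c • A) :=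
  (schattenNorm_smul_le hA.isCompactOperator c hp).trans_lt (ENNReal.mul_lt_top (by simp) hA)

theorem enorm_le_schattenNorm (K : H →L[ℂ] H) (hp : 1 ≤ p) : ‖K‖ₑ ≤ schattenNorm p K := by
  have hp0 : 0 < p := by linarith
  by_cases htop : schattenNorm p K = ∞
  · rw [htop]; exact le_top
  rw [← ofReal_norm]
  refine ENNReal.ofReal_le_of_le_toReal ?_
  refine ContinuousLinearMap.opNorm_le_of_unit_norm ENNReal.toReal_nonneg fun x hx => ?_
  by_cases hKx : K x = 0
  · simp [hKx]
  have hn : ‖K x‖ ≠ 0 := norm_ne_zero_iff.2 hKx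
  -- One-element orthonormal families, with $f=Kx/\|Kx\|$, recover $\|Kx\|$.
  have hsing : ∀ y : H, ‖y‖ = 1 → Orthonormal ℂ (fun _ : Unit => y) := fun y hy =>
    ⟨fun _ => hy, fun i j hij => (hij (Subsingleton.elim i j)).elim⟩
  have h := tsum_enorm_inner_rpow_le_schattenNorm K (hsing x hx)
    (hsing (((‖K x‖ : ℂ)⁻¹) • K x) (by rw [norm_smul]; simp [hn])) hp
  rw [tsum_fintype, Fintype.sum_unique, ← ENNReal.rpow_mul, mul_one_div_cancel hp0.ne',
    ENNReal.rpow_one] at h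
  rw [← ENNReal.ofReal_le_iff_le_toReal htop]
  refine le_trans (le_of_eq ?_) h
  rw [← ofReal_norm]
  congr 1
  rw [inner_smul_left, inner_self_eq_norm_sq_to_K]
  simp [hn, sq]

/-- Write $\langle u,ABv\rangle=\langle A^*u,Bv\rangle$ and apply Hölder to the vector norms, whose
$\ell^p$ and $\ell^q$ sums are controlled for exponents at least $2$. -/
theorem schattenNorm_mul_le (hA : IsCompactOperator A) {q r : ℝ} (hp : 2 ≤ p) (hq : 2 ≤ q)
    (h : 1 / r = 1 / p + 1 / q) :
    schattenNorm r (A * B) ≤ schattenNorm p A * schattenNorm q B := by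
  have hr : 0 < r := by
    rw [← one_div_pos, h]; positivity
  have hrp : r < p := by
    rw [← one_div_lt_one_div (by linarith) hr, h]
    simp only [one_div, lt_add_iff_pos_right, inv_pos]; linarith
  have hAB : IsCompactOperator (A * B) := hA.comp_clm B
  have h' := isSVD_of_isCompactOperator hAB
  rw [schattenNorm_eq_tsum_inner hAB]
  refine le_trans ?_ (mul_le_mul'
    (tsum_enorm_adjoint_apply_rpow_le_schattenNorm A h'.orthonormal_left hp)
    (tsum_enorm_apply_rpow_le_schattenNorm B h'.orthonormal_right hq))
  refine le_trans ?_ (tsum_mul_rpow_le _ _ hr hrp h)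
  refine ENNReal.rpow_le_rpow (ENNReal.tsum_le_tsum fun i => ?_) (by positivity)
  refine ENNReal.rpow_le_rpow ?_ hr.le
  rw [mul_apply_eq_comp, ← ContinuousLinearMap.adjoint_inner_left]
  simp only [← ofReal_norm]
  rw [← ENNReal.ofReal_mul (norm_nonneg _)]
  exact ENNReal.ofReal_le_ofReal (norm_inner_le_norm _ _)

end Schatten

/-! ### Hölder's inequality for the trace norm -/

section TraceHolder

variable {κ ι : Type*} {A B : H →L[ℂ] H} {p : ℝ} {σ : ι → ℝ} {u v : ι → H}

theorem enorm_inner_le_mul (x y : H) : ‖⟪x, y⟫_ℂ‖ₑ ≤ ‖x‖ₑ * ‖y‖ₑ := by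
  simp only [← ofReal_norm]
  rw [← ENNReal.ofReal_mul (norm_nonneg _)]
  exact ENNReal.ofReal_le_ofReal (norm_inner_le_norm _ _)

/-- Expand the middle factor in its singular value decomposition, use Cauchy-Schwarz with weights
$\sigma_i$ on the double sum, then Bessel in the index $j$. This reaches the trace norm where a
factor of exponent below $2$ would defeat `schattenNorm_mul_le`. -/
theorem IsSVD.tsum_enorm_inner_mul_mul_le (h : IsSVD A σ u v) (P Q : H →L[ℂ] H) {e f : κ → H}
    (he : Orthonormal ℂ e) (hf : Orthonormal ℂ f) :
    ∑' j, ‖⟪f j, P (A (Q (e j)))⟫_ℂ‖ₑ ≤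
      (∑' i, ENNReal.ofReal (σ i) * ‖P (u i)‖ₑ ^ 2) ^ (1 / 2 : ℝ) *
        (∑' i, ENNReal.ofReal (σ i) * ‖Q.adjoint (v i)‖ₑ ^ 2) ^ (1 / 2 : ℝ) := by
  calc ∑' j, ‖⟪f j, P (A (Q (e j)))⟫_ℂ‖ₑ
      ≤ ∑' j, ∑' i, ENNReal.ofReal (σ i) *
          (‖⟪f j, P (u i)⟫_ℂ‖ₑ * ‖⟪Q.adjoint (v i), e j⟫_ℂ‖ₑ) := by
        refine ENNReal.tsum_le_tsum fun j => ?_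
        rw [← ContinuousLinearMap.adjoint_inner_left]
        refine (h.enorm_inner_le _ _).trans (le_of_eq (tsum_congr fun i => ?_))
        rw [ContinuousLinearMap.adjoint_inner_left, ContinuousLinearMap.adjoint_inner_left,
          mul_comm ‖⟪f j, P (u i)⟫_ℂ‖ₑ]
    _ = ∑' x : κ × ι, ENNReal.ofReal (σ x.2) *
          (‖⟪f x.1, P (u x.2)⟫_ℂ‖ₑ * ‖⟪Q.adjoint (v x.2), e x.1⟫_ℂ‖ₑ) :=
        (ENNReal.tsum_prod' (f := fun x : κ × ι => ENNReal.ofReal (σ x.2) *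
          (‖⟪f x.1, P (u x.2)⟫_ℂ‖ₑ * ‖⟪Q.adjoint (v x.2), e x.1⟫_ℂ‖ₑ))).symm
    _ ≤ _ := tsum_weight_mul_mul_le _ _ _
    _ ≤ _ := by
        gcongr (?_ ^ (1 / 2 : ℝ)) * (?_ ^ (1 / 2 : ℝ))
        · rw [ENNReal.tsum_prod', ENNReal.tsum_comm]
          refine ENNReal.tsum_le_tsum fun i => ?_
          dsimp only
          rw [ENNReal.tsum_mul_left]
          gcongr
          exact tsum_enorm_inner_sq_le hf _
        · rw [ENNReal.tsum_prod', ENNReal.tsum_comm]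
          refine ENNReal.tsum_le_tsum fun i => ?_
          dsimp only
          rw [ENNReal.tsum_mul_left]
          gcongr
          exact tsum_enorm_inner_sq_le' he _

theorem schattenNorm_one_mul_le (hA : IsCompactOperator A) (B : H →L[ℂ] H) :
    schattenNorm 1 (A * B) ≤ schattenNorm 1 A * ‖B‖ₑ := by
  have hAB : IsCompactOperator (A * B) := hA.comp_clm B
  have h := isSVD_of_isCompactOperator hA
  have h' := isSVD_of_isCompactOperator hAB
  rw [schattenNorm_eq_tsum_inner hAB, schattenNorm_of_isCompactOperator hA]
  simp only [ENNReal.rpow_one, div_one]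
  set S := ∑' i : SingularIndex A, ENNReal.ofReal (singularNumber A i) with hS
  have h1 := h.tsum_enorm_inner_mul_mul_le 1 B h'.orthonormal_right h'.orthonormal_left
  refine h1.trans ?_
  have hP : ∑' i, ENNReal.ofReal (singularNumber A i) *
      ‖(1 : H →L[ℂ] H) (leftVec A i)‖ₑ ^ 2 = S := by
    refine tsum_congr fun i => ?_
    rw [one_apply_eq_self, h.orthonormal_left.enorm_eq_one, one_pow, mul_one]
  have hQ : ∑' i, ENNReal.ofReal (singularNumber A i) * ‖B.adjoint (rightVec A i)‖ₑ ^ 2 ≤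
      S * ‖B‖ₑ ^ 2 := by
    rw [hS, ← ENNReal.tsum_mul_right]
    refine ENNReal.tsum_le_tsum fun i => ?_
    gcongr
    refine (ContinuousLinearMap.le_opENorm _ _).trans ?_
    rw [h.orthonormal_right.enorm_eq_one, mul_one, ← ofReal_norm, LinearIsometryEquiv.norm_map,
      ofReal_norm]
  have hsq : ∀ x : ℝ≥0∞, x ^ (1 / 2 : ℝ) * x ^ (1 / 2 : ℝ) = x := fun x => by
    rw [← ENNReal.rpow_add_of_nonneg _ _ (by norm_num) (by norm_num)]
    norm_num
  calc _ ≤ S ^ (1 / 2 : ℝ) * (S * ‖B‖ₑ ^ 2) ^ (1 / 2 : ℝ) := by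
        rw [hP]; gcongr
    _ = S * ‖B‖ₑ := by
        rw [ENNReal.mul_rpow_of_nonneg _ _ (by norm_num), ← mul_assoc, hsq, ← ENNReal.rpow_two,
          ← ENNReal.rpow_mul]
        norm_num

theorem isCompactOperator_list_prod {L : List (H →L[ℂ] H)} (hL : L ≠ [])
    (h : ∀ T ∈ L, IsCompactOperator T) : IsCompactOperator L.prod := by
  cases L with
  | nil => exact absurd rfl hL
  | cons T L =>
    rw [List.prod_cons]
    exact (h T (by simp)).comp_clm L.prod

/-- Hölder's inequality for at most `m / 2` factors in `S_m`. -/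
theorem schattenNorm_list_prod_le {m : ℕ} (L : List (H →L[ℂ] H)) (hL : L ≠ [])
    (h : ∀ T ∈ L, IsCompactOperator T) (hm : 2 * L.length ≤ m) :
    schattenNorm (m / L.length) L.prod ≤ (L.map (schattenNorm m)).prod := by
  induction L with
  | nil => exact absurd rfl hL
  | cons T L ih =>
    by_cases hL' : L = []
    · subst hL'
      simp
    rw [List.prod_cons, List.map_cons, List.prod_cons, List.length_cons]
    rw [List.length_cons] at hm
    have hlen : 0 < L.length := List.length_pos_iff.2 hL'
    have hlen' : (0 : ℝ) < L.length := by exact_mod_cast hlen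
    have hm' : (2 : ℝ) * (L.length + 1) ≤ m := by exact_mod_cast hm
    have hm0 : (0 : ℝ) < m := by linarith
    refine (schattenNorm_mul_le (p := m) (q := m / L.length) (h T (by simp)) (by linarith) ?_
      ?_).trans ?_
    · rw [le_div_iff₀ hlen']; linarith
    · push_cast; field_simp; ring
    · gcongr
      exact ih hL' (fun S hS => h S (by simp [hS])) (by omega)

/-- Hölder with the conjugate exponents $m$ and $m/(2k)$, which is where $m=2k+1$ enters. -/
theorem tsum_mul_sq_le_schattenNorm {m k : ℕ} (hk : 1 ≤ k) (hm : m = 2 * k + 1)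
    (hA : IsCompactOperator A) (a : SingularIndex A → ℝ≥0∞) {C : ℝ≥0∞}
    (ha : (∑' i, a i ^ ((m : ℝ) / k)) ^ (1 / ((m : ℝ) / k)) ≤ C) :
    (∑' i, ENNReal.ofReal (singularNumber A i) * a i ^ 2) ^ (1 / 2 : ℝ) ≤
      schattenNorm m A ^ (1 / 2 : ℝ) * C := by
  have hk' : (1 : ℝ) ≤ k := by exact_mod_cast hk
  have hm' : (m : ℝ) = 2 * k + 1 := by exact_mod_cast hm
  have h := tsum_mul_le (fun i => ENNReal.ofReal (singularNumber A i)) (fun i => a i ^ 2)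
    (p := m) (q := m / (2 * k)) (by linarith) (by rw [hm']; field_simp; ring)
  have h2 : ∀ i, (a i ^ 2) ^ ((m : ℝ) / (2 * k)) = a i ^ ((m : ℝ) / k) := fun i => by
    rw [← ENNReal.rpow_two, ← ENNReal.rpow_mul]
    congr 1
    field_simp
  simp only [h2] at h
  calc _ ≤ (schattenNorm m A * C ^ 2) ^ (1 / 2 : ℝ) := by
        gcongr
        refine h.trans ?_
        rw [schattenNorm_of_isCompactOperator hA]
        gcongr
        calc _ = ((∑' i, a i ^ ((m : ℝ) / k)) ^ (1 / ((m : ℝ) / k))) ^ 2 := by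
              rw [← ENNReal.rpow_two, ← ENNReal.rpow_mul]
              congr 1
              field_simp
          _ ≤ C ^ 2 := by gcongr
    _ = _ := by
        rw [ENNReal.mul_rpow_of_nonneg _ _ (by norm_num), ← ENNReal.rpow_two, ← ENNReal.rpow_mul]
        norm_num

/-- Hölder's inequality: the product of `m` operators in `S_m` is of trace class. -/
theorem schattenNorm_one_list_prod_le {m : ℕ} (hm : 1 ≤ m) (L : List (H →L[ℂ] H))
    (h : ∀ T ∈ L, IsCompactOperator T) (hL : L.length = m) :
    schattenNorm 1 L.prod ≤ (L.map (schattenNorm m)).prod := by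
  have hne : L ≠ [] := by rintro rfl; simp at hL; omega
  have hc := isCompactOperator_list_prod hne h
  have h' := isSVD_of_isCompactOperator hc
  have hsq : ∀ x : ℝ≥0∞, x ^ (1 / 2 : ℝ) * x ^ (1 / 2 : ℝ) = x := fun x => by
    rw [← ENNReal.rpow_add_of_nonneg _ _ (by norm_num) (by norm_num)]
    norm_num
  rcases Nat.even_or_odd' m with ⟨k, hk | hk⟩
  -- Even $m$: two halves of $k$ factors each, both in $\mathcal S_2$, followed by Cauchy-Schwarz.
  · have hk1 : 1 ≤ k := by omega
    have hk' : (k : ℝ) ≠ 0 := by exact_mod_cast (by omega : k ≠ 0)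
    have key : ∀ L' : List (H →L[ℂ] H), L' ≠ [] → L'.length = k → (∀ T ∈ L', IsCompactOperator T) →
        schattenNorm 2 L'.prod ≤ (L'.map (schattenNorm m)).prod := by
      intro L' hne' hlen hcomp
      have := schattenNorm_list_prod_le L' hne' hcomp (m := m) (by omega)
      rwa [hlen, hk, show ((2 * k : ℕ) : ℝ) / k = 2 by push_cast; field_simp, ← hk] at this
    set P := L.take k
    set Q := L.drop k
    have hPlen : P.length = k := by simp [P]; omega
    have hQlen : Q.length = k := by simp [Q]; omega
    have hPQ : L = P ++ Q := (List.take_append_drop k L).symm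
    have hP := key P (by rintro hP; rw [hP] at hPlen; simp at hPlen; omega) hPlen
      (fun T hT => h T (List.mem_of_mem_take hT))
    have hQ := key Q (by rintro hQ; rw [hQ] at hQlen; simp at hQlen; omega) hQlen
      (fun T hT => h T (List.mem_of_mem_drop hT))
    rw [schattenNorm_eq_tsum_inner hc]
    simp only [ENNReal.rpow_one, div_one]
    have e1 : (L.map (schattenNorm m)).prod =
        (P.map (schattenNorm m)).prod * (Q.map (schattenNorm m)).prod := by
      rw [hPQ, List.map_append, List.prod_append]
    have e2 : ∀ i, ‖⟪leftVec L.prod i, L.prod (rightVec L.prod i)⟫_ℂ‖ₑ ≤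
        ‖P.prod.adjoint (leftVec L.prod i)‖ₑ * ‖Q.prod (rightVec L.prod i)‖ₑ := by
      intro i
      have : L.prod (rightVec L.prod i) = P.prod (Q.prod (rightVec L.prod i)) := by
        rw [← mul_apply_eq_comp, ← List.prod_append, ← hPQ]
      rw [this, ← ContinuousLinearMap.adjoint_inner_left]
      exact enorm_inner_le_mul _ _
    rw [e1]
    refine (ENNReal.tsum_le_tsum e2).trans ((tsum_mul_le _ _ (p := 2) (q := 2) (by norm_num)
      (by norm_num)).trans (mul_le_mul' (le_trans ?_ hP) (le_trans ?_ hQ)))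
    · exact tsum_enorm_adjoint_apply_rpow_le_schattenNorm _ h'.orthonormal_left le_rfl
    · exact tsum_enorm_apply_rpow_le_schattenNorm _ h'.orthonormal_right le_rfl
  · rcases Nat.eq_zero_or_pos k with rfl | hk1
    · have hm1 : m = 1 := by omega
      subst hm1
      obtain ⟨T, rfl⟩ := List.length_eq_one_iff.1 hL
      simp
    -- Odd $m$: the middle factor $A$ is left over, and the square root of its norm is charged to
    -- each of the two sides.
    set P := L.take k
    set Q := L.drop (k + 1)
    have hklt : k < L.length := by omega
    set A := L[k]
    have hPlen : P.length = k := by simp [P]; omega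
    have hQlen : Q.length = k := by simp [Q]; omega
    have hPQ : L = P ++ A :: Q := by
      simp [P, Q, A]
    have hAc : IsCompactOperator A := h A (List.getElem_mem hklt)
    have hA := isSVD_of_isCompactOperator hAc
    have hP := schattenNorm_list_prod_le (m := m) P
      (by rintro hP; rw [hP] at hPlen; simp at hPlen; omega)
      (fun T hT => h T (List.mem_of_mem_take hT)) (by omega)
    have hQ := schattenNorm_list_prod_le (m := m) Q
      (by rintro hQ; rw [hQ] at hQlen; simp at hQlen; omega)
      (fun T hT => h T (List.mem_of_mem_drop hT)) (by omega)
    rw [hPlen] at hP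
    rw [hQlen] at hQ
    have hmk : (2 : ℝ) ≤ m / k := by
      have : (0 : ℝ) < k := by exact_mod_cast hk1
      rw [le_div_iff₀ this]
      exact_mod_cast (by omega : 2 * k ≤ m)
    rw [schattenNorm_eq_tsum_inner hc]
    simp only [ENNReal.rpow_one, div_one]
    have e1 : (L.map (schattenNorm m)).prod = schattenNorm m A ^ (1 / 2 : ℝ) *
        (P.map (schattenNorm m)).prod * (schattenNorm m A ^ (1 / 2 : ℝ) *
          (Q.map (schattenNorm m)).prod) := by
      rw [mul_mul_mul_comm, hsq]
      conv_lhs => rw [hPQ]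
      rw [List.map_append, List.map_cons, List.prod_append, List.prod_cons]
      ring
    have e2 : ∀ i, L.prod (rightVec L.prod i) = P.prod (A (Q.prod (rightVec L.prod i))) := by
      intro i
      have : L.prod = P.prod * (A * Q.prod) := by
        conv_lhs => rw [hPQ]
        rw [List.prod_append, List.prod_cons]
      exact DFunLike.congr_fun this _
    rw [e1]
    simp only [e2]
    refine (hA.tsum_enorm_inner_mul_mul_le P.prod Q.prod h'.orthonormal_right
      h'.orthonormal_left).trans (mul_le_mul' ?_ ?_)
    · exact tsum_mul_sq_le_schattenNorm hk1 hk hAc _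
        ((tsum_enorm_apply_rpow_le_schattenNorm _ hA.orthonormal_left hmk).trans hP)
    · exact tsum_mul_sq_le_schattenNorm hk1 hk hAc _
        ((tsum_enorm_adjoint_apply_rpow_le_schattenNorm _ hA.orthonormal_right hmk).trans hQ)

end TraceHolder

/-! ### Finite rank approximation and continuity of traces of powers -/

section Convergence

variable {A F : H →L[ℂ] H} {p : ℝ} {m : ℕ}

theorem schattenNorm_zero (hp : 1 ≤ p) : schattenNorm p (0 : H →L[ℂ] H) = 0 := by
  have h0 : IsCompactOperator (0 : H →L[ℂ] H) := isCompactOperator_zero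
  simpa using schattenNorm_smul_le h0 0 hp

theorem isCompactOperator_sum {ι : Type*} (s : Finset ι) (T : ι → H →L[ℂ] H)
    (h : ∀ i ∈ s, IsCompactOperator (T i)) : IsCompactOperator (∑ i ∈ s, T i : H →L[ℂ] H) := by
  classical
  induction s using Finset.induction_on with
  | empty => rw [Finset.sum_empty]; exact isCompactOperator_zero
  | insert i s hi ih =>
    rw [Finset.sum_insert hi]
    exact (h i (by simp)).add (ih fun j hj => h j (by simp [hj]))

theorem schattenNorm_sum_le {ι : Type*} (s : Finset ι) (T : ι → H →L[ℂ] H)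
    (h : ∀ i ∈ s, IsCompactOperator (T i)) (hp : 1 ≤ p) :
    schattenNorm p (∑ i ∈ s, T i) ≤ ∑ i ∈ s, schattenNorm p (T i) := by
  classical
  induction s using Finset.induction_on with
  | empty => simp [schattenNorm_zero hp]
  | insert i s hi ih =>
    rw [Finset.sum_insert hi, Finset.sum_insert hi]
    refine (schattenNorm_add_le (h i (by simp))
      (isCompactOperator_sum s T fun j hj => h j (by simp [hj])) hp).trans ?_
    gcongr
    exact ih fun j hj => h j (by simp [hj])

theorem IsCompactOperator.pow {T : H →L[ℂ] H} (hT : IsCompactOperator T) {n : ℕ} (hn : 1 ≤ n) :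
    IsCompactOperator (T ^ n : H →L[ℂ] H) := by
  obtain ⟨k, rfl⟩ := Nat.exists_eq_add_of_le' hn
  rw [pow_succ']
  exact hT.comp_clm (T ^ k)

theorem schattenNorm_one_pow_le (hm : 1 ≤ m) (hA : IsCompactOperator A) :
    schattenNorm 1 (A ^ m) ≤ schattenNorm m A ^ m := by
  have := schattenNorm_one_list_prod_le hm (List.replicate m A)
    (fun T hT => (List.eq_of_mem_replicate hT) ▸ hA) (by simp)
  simpa using this

theorem schattenNorm_one_pow_sub_pow_le (hm : 1 ≤ m) (hA : IsCompactOperator A)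
    (hF : IsCompactOperator F) {C : ℝ≥0∞} (hAC : schattenNorm m A ≤ C) (hFC : schattenNorm m F ≤ C) :
    schattenNorm 1 (F ^ m - A ^ m) ≤ m * (schattenNorm m (F - A) * C ^ (m - 1)) := by
  have hX : IsCompactOperator (F - A : H →L[ℂ] H) := hF.sub hA
  -- Telescoping into words of length $m$ with a single letter $F-A$, so that Hölder applies to each
  -- word.
  have hsum : F ^ m - A ^ m =
      ∑ a ∈ Finset.range m,
        (List.replicate a F ++ (F - A) :: List.replicate (m - 1 - a) A).prod := by
    have h := Finset.sum_range_sub (fun a => F ^ a * A ^ (m - a)) m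
    simp only [pow_zero, Nat.sub_zero, one_mul, Nat.sub_self, mul_one] at h
    rw [← h]
    refine Finset.sum_congr rfl fun a ha => ?_
    have ha' : a < m := Finset.mem_range.1 ha
    rw [List.prod_append, List.prod_cons, List.prod_replicate, List.prod_replicate,
      show m - (a + 1) = m - 1 - a by omega, show m - a = (m - 1 - a) + 1 by omega, pow_succ F,
      pow_succ' A, sub_mul, mul_sub, mul_assoc]
  have hmem : ∀ a, ∀ T ∈ List.replicate a F ++ (F - A) :: List.replicate (m - 1 - a) A,
      IsCompactOperator T := by
    intro a T hT
    rcases List.mem_append.1 hT with hT | hT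
    · exact (List.eq_of_mem_replicate hT) ▸ hF
    · rcases List.mem_cons.1 hT with hT | hT
      · exact hT ▸ hX
      · exact (List.eq_of_mem_replicate hT) ▸ hA
  rw [hsum]
  refine (schattenNorm_sum_le _ _ (fun a _ => isCompactOperator_list_prod (by simp) (hmem a))
    le_rfl).trans ?_
  refine (Finset.sum_le_card_nsmul _ _ (schattenNorm m (F - A) * C ^ (m - 1)) fun a ha => ?_).trans
    (by simp)
  have ha' : a < m := Finset.mem_range.1 ha
  refine (schattenNorm_one_list_prod_le hm _ (hmem a) (by simp; omega)).trans ?_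
  rw [List.map_append, List.map_cons, List.map_replicate, List.map_replicate, List.prod_append,
    List.prod_cons, List.prod_replicate, List.prod_replicate]
  calc _ ≤ C ^ a * (schattenNorm m (F - A) * C ^ (m - 1 - a)) := by gcongr
    _ = schattenNorm m (F - A) * C ^ (a + (m - 1 - a)) := by rw [pow_add]; ring
    _ = _ := by rw [show a + (m - 1 - a) = m - 1 by omega]

theorem enorm_opTrace_le (T : H →L[ℂ] H) : ‖opTrace T‖ₑ ≤ schattenNorm 1 T :=
  enorm_tsum_le_tsum_enorm.trans (tsum_enorm_inner_le_schattenNorm T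
    (someHilbertBasis H).orthonormal (someHilbertBasis H).orthonormal)

theorem summable_inner_of_memSchatten_one {T : H →L[ℂ] H} (hT : MemSchatten 1 T) :
    Summable fun i => ⟪someHilbertBasis H i, T (someHilbertBasis H i)⟫_ℂ := by
  have h := (tsum_enorm_inner_le_schattenNorm T (someHilbertBasis H).orthonormal
    (someHilbertBasis H).orthonormal).trans_lt hT
  refine Summable.of_nnnorm ?_
  rw [← ENNReal.tsum_coe_ne_top_iff_summable]
  exact h.ne

theorem opTrace_sub {S T : H →L[ℂ] H} (hS : MemSchatten 1 S) (hT : MemSchatten 1 T) :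
    opTrace (S - T) = opTrace S - opTrace T := by
  unfold opTrace
  rw [← (summable_inner_of_memSchatten_one hS).tsum_sub (summable_inner_of_memSchatten_one hT)]
  simp only [sub_apply, inner_sub_right]

theorem opTrace_smul (c : ℂ) (T : H →L[ℂ] H) : opTrace (c • T) = c * opTrace T := by
  unfold opTrace
  rw [← tsum_mul_left]
  simp only [smul_apply, inner_smul_right]

theorem tendsto_schattenNorm_sub (p : ℝ) (A : H →L[ℂ] H) :
    Tendsto (fun F => schattenNorm p (F - A)) (finiteRankNhds p A) (𝓝 0) :=
  tendsto_comap.mono_left inf_le_left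

theorem eventually_isFiniteRank (p : ℝ) (A : H →L[ℂ] H) :
    ∀ᶠ F in finiteRankNhds p A, IsFiniteRank F :=
  (mem_principal_self _ : {F : H →L[ℂ] H | IsFiniteRank F} ∈ 𝓟 _) |> mem_inf_of_right

theorem eventually_isCompactOperator (hA : MemSchatten p A) :
    ∀ᶠ F : H →L[ℂ] H in finiteRankNhds p A, IsCompactOperator F := by
  filter_upwards [(tendsto_schattenNorm_sub p A).eventually (gt_mem_nhds ENNReal.zero_lt_top)]
    with F hF
  have h := (MemSchatten.isCompactOperator hF).add hA.isCompactOperator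
  rw [← FunLike.coe_add, sub_add_cancel] at h
  exact h

theorem eventually_schattenNorm_le (hp : 1 ≤ p) (hA : MemSchatten p A) :
    ∀ᶠ F in finiteRankNhds p A, schattenNorm p F ≤ schattenNorm p A + 1 := by
  filter_upwards [(tendsto_schattenNorm_sub p A).eventually (gt_mem_nhds one_pos)]
    with F hF
  have h := schattenNorm_add_le hA.isCompactOperator
    (MemSchatten.isCompactOperator (hF.trans ENNReal.one_lt_top)) hp
  rw [add_sub_cancel] at h
  exact h.trans (by gcongr)

theorem tendsto_schattenNorm_pow_sub_pow (hm : 1 ≤ m) (hA : MemSchatten m A) :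
    Tendsto (fun F => schattenNorm 1 (F ^ m - A ^ m)) (finiteRankNhds m A) (𝓝 0) := by
  have hp : (1 : ℝ) ≤ m := by exact_mod_cast hm
  have hC : schattenNorm m A + 1 < ∞ := ENNReal.add_lt_top.2 ⟨hA, ENNReal.one_lt_top⟩
  have hlim : Tendsto (fun F => m * (schattenNorm m (F - A) * (schattenNorm m A + 1) ^ (m - 1)))
      (finiteRankNhds m A) (𝓝 (m * (0 * (schattenNorm m A + 1) ^ (m - 1)))) :=
    ENNReal.Tendsto.const_mul (ENNReal.Tendsto.mul_const (tendsto_schattenNorm_sub m A)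
      (Or.inr (ENNReal.pow_lt_top hC).ne)) (Or.inr (ENNReal.natCast_ne_top m))
  rw [zero_mul, mul_zero] at hlim
  refine tendsto_of_tendsto_of_tendsto_of_le_of_le' tendsto_const_nhds hlim
    (Eventually.of_forall fun _ => zero_le) ?_
  filter_upwards [eventually_isCompactOperator hA, eventually_schattenNorm_le hp hA] with F hF hF'
  exact schattenNorm_one_pow_sub_pow_le hm hA.isCompactOperator hF le_self_add hF'

theorem memSchatten_one_pow (hm : 1 ≤ m) (hA : MemSchatten m A) : MemSchatten 1 (A ^ m) :=
  (schattenNorm_one_pow_le hm hA.isCompactOperator).trans_lt (ENNReal.pow_lt_top hA)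

theorem eventually_schattenNorm_pow_le (hm : 1 ≤ m) (hA : MemSchatten m A) {ε : ℝ≥0∞}
    (hε : 0 < ε) :
    ∀ᶠ F in finiteRankNhds m A, schattenNorm 1 (F ^ m) ≤ schattenNorm 1 (A ^ m) + ε := by
  filter_upwards [(tendsto_schattenNorm_pow_sub_pow hm hA).eventually (gt_mem_nhds hε),
    eventually_isCompactOperator hA] with F hF hFc
  have h := schattenNorm_add_le (IsCompactOperator.pow hA.isCompactOperator hm)
    (A := A ^ m) (B := F ^ m - A ^ m) ((IsCompactOperator.pow hFc hm).sub
    (IsCompactOperator.pow hA.isCompactOperator hm)) le_rfl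
  rw [add_sub_cancel] at h
  exact h.trans (by gcongr)

theorem tendsto_id_finiteRankNhds (hp : 1 ≤ p) (A : H →L[ℂ] H) :
    Tendsto id (finiteRankNhds p A) (𝓝 A) := by
  rw [tendsto_iff_edist_tendsto_0]
  refine tendsto_of_tendsto_of_tendsto_of_le_of_le tendsto_const_nhds (tendsto_schattenNorm_sub p A)
    (fun _ => zero_le) fun F => ?_
  rw [edist_eq_enorm_sub]
  exact enorm_le_schattenNorm _ hp

/-- With $n=m+l$, the factor $F^m$ converges in trace norm and $F^l$ in operator norm; the trace is
bounded by the trace norm. -/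
theorem tendsto_opTrace_pow (hm : 1 ≤ m) (hA : MemSchatten m A) {n : ℕ} (hn : m ≤ n) :
    Tendsto (fun F => opTrace (F ^ n)) (finiteRankNhds m A) (𝓝 (opTrace (A ^ n))) := by
  have hp : (1 : ℝ) ≤ m := by exact_mod_cast hm
  obtain ⟨l, rfl⟩ := Nat.exists_eq_add_of_le hn
  have hAc := hA.isCompactOperator
  have hA1 := memSchatten_one_pow hm hA
  have hpow : Tendsto (fun F : H →L[ℂ] H => F ^ l) (finiteRankNhds m A) (𝓝 (A ^ l)) :=
    ((continuous_pow l).tendsto A).comp (tendsto_id_finiteRankNhds hp A)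
  have h1 : Tendsto (fun F => schattenNorm 1 (F ^ m - A ^ m) * ‖F ^ l‖ₑ) (finiteRankNhds m A)
      (𝓝 (0 * ‖A ^ l‖ₑ)) :=
    ENNReal.Tendsto.mul (tendsto_schattenNorm_pow_sub_pow hm hA) (Or.inr (by simp))
      hpow.enorm (Or.inr (by simp))
  have h2 : Tendsto (fun F => schattenNorm 1 (A ^ m) * ‖F ^ l - A ^ l‖ₑ) (finiteRankNhds m A)
      (𝓝 (schattenNorm 1 (A ^ m) * 0)) := by
    refine ENNReal.Tendsto.const_mul ?_ (Or.inr (ne_of_lt hA1))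
    simpa using (hpow.sub_const (A ^ l)).enorm
  have h12 := h1.add h2
  rw [zero_mul, mul_zero, add_zero] at h12
  rw [tendsto_iff_edist_tendsto_0]
  refine tendsto_of_tendsto_of_tendsto_of_le_of_le' tendsto_const_nhds h12
    (Eventually.of_forall fun _ => zero_le) ?_
  filter_upwards [eventually_isCompactOperator hA, eventually_schattenNorm_le hp hA] with F hF hF'
  have hF0 : MemSchatten m F := hF'.trans_lt (ENNReal.add_lt_top.2 ⟨hA, ENNReal.one_lt_top⟩)
  have hF1 := memSchatten_one_pow hm hF0
  have hFn : MemSchatten 1 (F ^ (m + l)) := by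
    rw [pow_add]
    exact (schattenNorm_one_mul_le (IsCompactOperator.pow hF hm) _).trans_lt
      (ENNReal.mul_lt_top hF1 (by simp))
  have hAn : MemSchatten 1 (A ^ (m + l)) := by
    rw [pow_add]
    exact (schattenNorm_one_mul_le (IsCompactOperator.pow hAc hm) _).trans_lt
      (ENNReal.mul_lt_top hA1 (by simp))
  rw [edist_eq_enorm_sub, ← opTrace_sub hFn hAn]
  refine (enorm_opTrace_le _).trans ?_
  have hFA : IsCompactOperator (F ^ m - A ^ m : H →L[ℂ] H) :=
    (IsCompactOperator.pow hF hm).sub (IsCompactOperator.pow hAc hm)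
  have hsplit : F ^ (m + l) - A ^ (m + l) =
      (F ^ m - A ^ m) * F ^ l + A ^ m * (F ^ l - A ^ l) := by
    rw [pow_add, pow_add, sub_mul, mul_sub]; abel
  rw [hsplit]
  refine (schattenNorm_add_le (hFA.comp_clm (F ^ l))
    ((IsCompactOperator.pow hAc hm).comp_clm (F ^ l - A ^ l)) le_rfl).trans ?_
  exact add_le_add (schattenNorm_one_mul_le hFA _)
    (schattenNorm_one_mul_le (IsCompactOperator.pow hAc hm) _)

theorem isCompactOperator_rankOne (x y : H) :
    IsCompactOperator (InnerProductSpace.rankOne ℂ x y : H →L[ℂ] H) := by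
  have h := (isCompactOperator_id (E := ℂ)).comp_clm (innerSL ℂ y)
  exact h.clm_comp (ContinuousLinearMap.toSpanSingleton ℂ x)

/-- Partial sums of a singular value decomposition. -/
def svdTrunc (A : H →L[ℂ] H) (s : Finset (SingularIndex A)) : H →L[ℂ] H :=
  ∑ i ∈ s, (singularNumber A i : ℂ) • InnerProductSpace.rankOne ℂ (leftVec A i) (rightVec A i)

theorem svdTrunc_apply (A : H →L[ℂ] H) (s : Finset (SingularIndex A)) (x : H) :
    svdTrunc A s x =
      ∑ i ∈ s, (singularNumber A i : ℂ) • ⟪rightVec A i, x⟫_ℂ • leftVec A i := by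
  simp [svdTrunc, sum_apply]

theorem isFiniteRank_svdTrunc (A : H →L[ℂ] H) (s : Finset (SingularIndex A)) :
    IsFiniteRank (svdTrunc A s) := by
  classical
  have hle : LinearMap.range (svdTrunc A s : H →ₗ[ℂ] H) ≤
      Submodule.span ℂ ((s.image (leftVec A) : Finset H) : Set H) := by
    rintro _ ⟨x, rfl⟩
    rw [ContinuousLinearMap.coe_coe, svdTrunc_apply]
    refine Submodule.sum_mem _ fun i hi => Submodule.smul_mem _ _ (Submodule.smul_mem _ _ ?_)
    exact Submodule.subset_span (by simpa using ⟨i.1, i.1.2, i.2, by simpa using hi, rfl⟩)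
  exact Submodule.finiteDimensional_of_le hle

/-- Keeping the vectors and zeroing finitely many singular numbers makes the error of truncation the
tail of the convergent sum $\sum s_i^p$. -/
theorem isSVD_sub_svdTrunc [DecidableEq (SingularIndex A)] (hA : IsCompactOperator A)
    (s : Finset (SingularIndex A)) :
    IsSVD (A - svdTrunc A s) (fun i => if i ∈ s then 0 else singularNumber A i) (leftVec A)
      (rightVec A) := by
  have h := isSVD_of_isCompactOperator hA
  refine ⟨fun i => ?_, h.orthonormal_left, h.orthonormal_right, fun x y => ?_⟩
  · split_ifs
    · exact le_rfl
    · exact h.nonneg i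
  · rw [sub_apply, inner_sub_right, svdTrunc_apply, inner_sum]
    have h1 := (h.hasSum x y).sub (hasSum_sum_of_ne_finset_zero (s := s)
      (f := fun i => if i ∈ s then ⟪y, (singularNumber A i : ℂ) • ⟪rightVec A i, x⟫_ℂ • leftVec A i⟫_ℂ
        else 0) (fun i hi => if_neg hi))
    rw [Finset.sum_congr rfl (fun i hi => if_pos hi)] at h1
    convert! h1 using 1
    ext i
    split_ifs
    · simp only [inner_smul_right]; push_cast; ring
    · simp

/-- Density of the finite rank operators. It makes limits along this filter unique, so that `regDet`
is a genuine value, and lets bounds pass to the limit. -/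
theorem finiteRankNhds_neBot (hp : 1 ≤ p) (hA : MemSchatten p A) : (finiteRankNhds p A).NeBot := by
  classical
  have hp0 : 0 < p := by linarith
  have hAc := hA.isCompactOperator
  rw [finiteRankNhds, inf_principal_neBot_iff]
  rintro U ⟨t, ht, htU⟩
  obtain ⟨ε, hε, hεt⟩ := ENNReal.nhds_zero_basis.mem_iff.1 ht
  suffices h : ∃ s, schattenNorm p (svdTrunc A s - A) < ε by
    obtain ⟨s, hs⟩ := h
    exact ⟨svdTrunc A s, htU (hεt hs), isFiniteRank_svdTrunc A s⟩
  have hfin : ∑' i : SingularIndex A, ENNReal.ofReal (singularNumber A i) ^ p ≠ ∞ := by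
    intro htop
    rw [MemSchatten, schattenNorm_of_isCompactOperator hAc, htop,
      ENNReal.top_rpow_of_pos (by positivity)] at hA
    exact lt_irrefl _ hA
  have hlim := ENNReal.tendsto_tsum_compl_atTop_zero hfin
  have hlim2 := (ENNReal.continuous_rpow_const (y := 1 / p)).continuousAt.tendsto.comp hlim
  rw [ENNReal.zero_rpow_of_pos (by positivity)] at hlim2
  obtain ⟨s, hs⟩ := (hlim2.eventually (gt_mem_nhds hε)).exists
  refine ⟨s, lt_of_le_of_lt ?_ hs⟩
  have htc : IsCompactOperator (svdTrunc A s) :=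
    isCompactOperator_sum _ _ fun i _ => (isCompactOperator_rankOne _ _).smul _
  have hc : IsCompactOperator (A - svdTrunc A s : H →L[ℂ] H) := hAc.sub htc
  have h1 := schattenNorm_smul_le hc (-1) hp
  rw [neg_smul, one_smul, neg_sub] at h1
  refine h1.trans ?_
  rw [enorm_neg, enorm_one, one_mul]
  refine ((isSVD_sub_svdTrunc hAc s).schattenNorm_le hc hp).trans ?_
  refine ENNReal.rpow_le_rpow (le_of_eq ?_) (by positivity)
  have := tsum_subtype {x | x ∉ s} (fun i => ENNReal.ofReal (singularNumber A i) ^ p)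
  refine Eq.trans (tsum_congr fun i => ?_) this.symm
  by_cases hi : i ∈ s <;> simp [Set.indicator, hi, hp0]

end Convergence

/-! ### Schur triangulation and eigenvalues of finite rank operators -/

section Schur

theorem exists_orthonormal_upperTriangular (n : ℕ) : ∀ (V : Type*) [NormedAddCommGroup V]
    [InnerProductSpace ℂ V] [FiniteDimensional ℂ V] (_ : Module.finrank ℂ V = n)
    (T : V →ₗ[ℂ] V), ∃ e : Fin n → V, Orthonormal ℂ e ∧ ∀ i j, j < i → ⟪e i, T (e j)⟫_ℂ = 0 := by
  induction n with
  | zero =>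
    intro V _ _ _ _ T
    exact ⟨Fin.elim0, ⟨fun i => i.elim0, fun i => i.elim0⟩, fun i => i.elim0⟩
  | succ n ih =>
    intro V _ _ _ hV T
    have : Nontrivial V := Module.nontrivial_of_finrank_pos (R := ℂ) (by omega)
    -- An eigenvector $w$ of the adjoint has a $T$-invariant orthogonal complement; triangulate
    -- there and put $w$ last.
    obtain ⟨μ, hμ⟩ := Module.End.exists_eigenvalue (LinearMap.adjoint T)
    obtain ⟨w₀, hw₀⟩ := hμ.exists_hasEigenvector
    have hw₀n : ‖w₀‖ ≠ 0 := norm_ne_zero_iff.2 hw₀.2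
    set w : V := ((‖w₀‖ : ℂ)⁻¹) • w₀ with hw
    have hwn : ‖w‖ = 1 := by rw [hw, norm_smul]; simp [hw₀n]
    have hTw : LinearMap.adjoint T w = μ • w := by
      rw [hw, map_smul, hw₀.apply_eq_smul, smul_comm]
    set W : Submodule ℂ V := (ℂ ∙ w)ᗮ with hW
    have hWmem : ∀ x, x ∈ W ↔ ⟪w, x⟫_ℂ = 0 := fun x => Submodule.mem_orthogonal_singleton_iff_inner_right
    have hinv : ∀ x ∈ W, T x ∈ W := by
      intro x hx
      rw [hWmem] at hx ⊢
      rw [← LinearMap.adjoint_inner_left, hTw, inner_smul_left, hx, mul_zero]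
    have hWd : Module.finrank ℂ W = n := by
      have : Fact (Module.finrank ℂ V = n + 1) := ⟨hV⟩
      exact Submodule.finrank_orthogonal_span_singleton (norm_ne_zero_iff.1 (by rw [hwn]; simp))
    obtain ⟨e, he, hT⟩ := ih W hWd (T.restrict hinv)
    refine ⟨Fin.snoc (fun i => (e i : V)) w, ⟨fun i => ?_, fun i j hij => ?_⟩, fun i j hij => ?_⟩
    · induction i using Fin.lastCases with
      | last => simpa using hwn
      | cast i => simpa using he.1 i
    · induction i using Fin.lastCases with
      | last =>
        induction j using Fin.lastCases with
        | last => exact absurd rfl hij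
        | cast j => simpa using (hWmem _).1 (e j).2
      | cast i =>
        induction j using Fin.lastCases with
        | last =>
          simp only [Fin.snoc_castSucc, Fin.snoc_last]
          rw [← inner_conj_symm, (hWmem _).1 (e i).2, map_zero]
        | cast j =>
          simp only [Fin.snoc_castSucc]
          exact he.2 (fun h => hij (by rw [h]))
    · induction j using Fin.lastCases with
      | last => exact absurd hij (not_lt.2 (Fin.le_last i))
      | cast j =>
        induction i using Fin.lastCases with
        | last => simpa using (hWmem _).1 (hinv _ (e j).2)
        | cast i =>
          simp only [Fin.snoc_castSucc]
          exact hT i j (by simpa using hij)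

/-- Schur triangulation. -/
theorem exists_orthonormalBasis_upperTriangular {V : Type*} [NormedAddCommGroup V]
    [InnerProductSpace ℂ V] [FiniteDimensional ℂ V] (T : V →ₗ[ℂ] V) :
    ∃ b : OrthonormalBasis (Fin (Module.finrank ℂ V)) ℂ V,
      (LinearMap.toMatrix b.toBasis b.toBasis T).BlockTriangular id := by
  obtain ⟨e, he, hT⟩ := exists_orthonormal_upperTriangular _ V rfl T
  have hsp := he.linearIndependent.span_eq_top_of_card_eq_finrank' (by simp)
  refine ⟨OrthonormalBasis.mk he hsp.ge, fun i j hij => ?_⟩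
  rw [LinearMap.toMatrix_apply]
  have := hT i j hij
  rw [OrthonormalBasis.coe_toBasis, OrthonormalBasis.coe_mk, OrthonormalBasis.coe_toBasis_repr_apply,
    OrthonormalBasis.repr_apply_apply, OrthonormalBasis.coe_mk]
  exact this

theorem diag_mul_of_upperTriangular {n : ℕ} {M N : Matrix (Fin n) (Fin n) ℂ}
    (hM : M.BlockTriangular id) (hN : N.BlockTriangular id) (i : Fin n) :
    (M * N) i i = M i i * N i i := by
  rw [Matrix.mul_apply]
  refine Finset.sum_eq_single i (fun k _ hk => ?_) (by simp)
  rcases lt_or_gt_of_ne hk with h | h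
  · rw [hM h, zero_mul]
  · rw [hN h, mul_zero]

theorem diag_pow_of_upperTriangular {n : ℕ} {M : Matrix (Fin n) (Fin n) ℂ}
    (hM : M.BlockTriangular id) (i : Fin n) (k : ℕ) : (M ^ k) i i = M i i ^ k := by
  induction k with
  | zero => simp
  | succ k ih => rw [pow_succ, pow_succ, diag_mul_of_upperTriangular (hM.pow k) hM, ih]

end Schur

/-- Moves the trace from the chosen Hilbert basis to a basis adapted to the range: expand $TB_i$ in
$b$ and sum over $i$ by Parseval. -/
theorem opTrace_eq_sum_of_range_le {ι : Type*} [Fintype ι] {V : Submodule ℂ H}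
    (b : OrthonormalBasis ι ℂ V) (T : H →L[ℂ] H) (hT : ∀ x, T x ∈ V) :
    opTrace T = ∑ j, ⟪(b j : H), T (b j)⟫_ℂ := by
  have hexp : ∀ x, T x = ∑ j, ⟪(b j : H), T x⟫_ℂ • (b j : H) := by
    intro x
    have h := congrArg Subtype.val (b.sum_repr' ⟨T x, hT x⟩)
    simp only [Submodule.coe_sum, Submodule.coe_smul] at h
    exact h.symm
  set B := someHilbertBasis H
  have hs : HasSum (fun i => ⟪B i, T (B i)⟫_ℂ)
      (∑ j, ⟪T.adjoint (b j : H), (b j : H)⟫_ℂ) := by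
    have h1 := hasSum_sum (s := Finset.univ)
      (fun j _ => B.hasSum_inner_mul_inner (T.adjoint (b j : H)) (b j : H))
    convert! h1 using 1
    ext i
    conv_lhs => rw [hexp (B i)]
    rw [inner_sum]
    refine Finset.sum_congr rfl fun j _ => ?_
    rw [inner_smul_right, ContinuousLinearMap.adjoint_inner_left]
  rw [opTrace, hs.tsum_eq]
  exact Finset.sum_congr rfl fun j _ => ContinuousLinearMap.adjoint_inner_left _ _ _

/-- The eigenvalues of an operator of finite rank, read off from a Schur triangulation. -/
theorem IsFiniteRank.exists_triangulation {F : H →L[ℂ] H} (hF : IsFiniteRank F) :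
    ∃ (n : ℕ) (e : Fin n → H) (μ : Fin n → ℂ), Orthonormal ℂ e ∧
      (∀ k, 1 ≤ k → ∀ j, ⟪e j, (F ^ k) (e j)⟫_ℂ = μ j ^ k) ∧
      finiteRankDet F = ∏ j, (1 - μ j) ∧
      ∀ k, 1 ≤ k → opTrace (F ^ k) = ∑ j, μ j ^ k := by
  have : FiniteDimensional ℂ (LinearMap.range (F : H →ₗ[ℂ] H)) := hF
  set V := LinearMap.range (F : H →ₗ[ℂ] H) with hV
  set T : V →ₗ[ℂ] V := (F : H →ₗ[ℂ] H).restrict (p := V) (q := V)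
    (fun x _ => LinearMap.mem_range_self _ x) with hT
  obtain ⟨b, hb⟩ := exists_orthonormalBasis_upperTriangular T
  set M := LinearMap.toMatrix b.toBasis b.toBasis T with hM
  have hTk : ∀ (k : ℕ) (x : V), (((T ^ k) x : V) : H) = (F ^ k) (x : H) := by
    intro k
    induction k with
    | zero => intro x; simp
    | succ k ih => intro x; rw [pow_succ, pow_succ, Module.End.mul_apply, ih]; rfl
  have hdiag : ∀ (k : ℕ) (j), ⟪(b j : H), (F ^ k) (b j : H)⟫_ℂ = M j j ^ k := by
    intro k j
    rw [← diag_pow_of_upperTriangular hb, hM, LinearMap.toMatrix_pow, LinearMap.toMatrix_apply,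
      OrthonormalBasis.coe_toBasis, OrthonormalBasis.coe_toBasis_repr_apply,
      OrthonormalBasis.repr_apply_apply, ← hTk]
    rfl
  refine ⟨_, fun j => (b j : H), fun j => M j j, ?_, fun k _ j => hdiag k j, ?_, fun k hk => ?_⟩
  · exact b.orthonormal.comp_linearIsometry V.subtypeₗᵢ
  · have h1 : finiteRankDet F = LinearMap.det (LinearMap.id - T) := rfl
    rw [h1, ← LinearMap.det_toMatrix b.toBasis, map_sub, LinearMap.toMatrix_id,
      Matrix.det_of_isUpperTriangular]
    · exact Finset.prod_congr rfl fun j _ => by simp [hM]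
    · exact Matrix.blockTriangular_one.sub hb
  · rw [opTrace_eq_sum_of_range_le b (F ^ k) (fun x => ?_)]
    · exact Finset.sum_congr rfl fun j _ => hdiag k j
    · obtain ⟨l, rfl⟩ := Nat.exists_eq_add_of_le' hk
      rw [pow_succ']
      exact ⟨(F ^ l) x, rfl⟩

/-! ### Weierstrass primary factors and their finite products -/

section PrimaryFactor

/-- The exponent `∑_{k=1}^{m-1} u ^ k / k` of the primary factor. -/
def primaryExponent {𝕜 : Type*} [Field 𝕜] (m : ℕ) (u : 𝕜) : 𝕜 := ∑ k ∈ Finset.Ico 1 m, u ^ k / k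

/-- The Weierstrass primary factor `E(u) = (1 - u) exp (∑_{k=1}^{m-1} u ^ k / k)`. -/
def primaryFactor (m : ℕ) (u : ℂ) : ℂ := (1 - u) * Complex.exp (primaryExponent m u)

variable {m : ℕ}

theorem primaryFactor_zero : primaryFactor m 0 = 1 := by
  have : primaryExponent m (0 : ℂ) = 0 := Finset.sum_eq_zero fun k hk => by
    rw [zero_pow (by have := (Finset.mem_Ico.1 hk).1; omega), zero_div]
  simp [primaryFactor, this]

/-- The geometric sum from the exponent cancels all but $u^{m-1}$; this is why $E_m-1$ vanishes to
order $m$ at $0$. -/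
theorem hasDerivAt_primaryFactor (hm : 1 ≤ m) (u : ℂ) :
    HasDerivAt (primaryFactor m) (-(u ^ (m - 1) * Complex.exp (primaryExponent m u))) u := by
  obtain ⟨l, rfl⟩ := Nat.exists_eq_add_of_le' hm
  have hexp : HasDerivAt (primaryExponent (l + 1)) (∑ k ∈ Finset.range l, u ^ k) u := by
    have : primaryExponent (l + 1) = fun u : ℂ =>
        ∑ k ∈ Finset.range l, u ^ (1 + k) / ((1 + k : ℕ) : ℂ) := by
      ext u
      rw [primaryExponent, Finset.sum_Ico_eq_sum_range, Nat.add_sub_cancel]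
    rw [this]
    refine HasDerivAt.fun_sum fun k _ => ?_
    have h := (hasDerivAt_pow (1 + k) u).div_const ((1 + k : ℕ) : ℂ)
    have hk : ((1 + k : ℕ) : ℂ) ≠ 0 := by exact_mod_cast (by omega : 1 + k ≠ 0)
    rw [mul_div_right_comm, div_self hk, one_mul, Nat.add_sub_cancel_left] at h
    exact h
  have h := ((hasDerivAt_id u).const_sub 1).mul hexp.cexp
  have hgeom : (1 - u) * ∑ k ∈ Finset.range l, u ^ k = 1 - u ^ l := mul_neg_geom_sum u l
  refine h.congr_deriv ?_
  simp only [id, Nat.add_sub_cancel]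
  linear_combination Complex.exp (primaryExponent (l + 1) u) * hgeom

theorem norm_exp_primaryExponent_le {u : ℂ} {R : ℝ} (hu : ‖u‖ ≤ R) :
    ‖Complex.exp (primaryExponent m u)‖ ≤ Real.exp (primaryExponent m R) := by
  refine (Complex.norm_exp_le_exp_norm _).trans (Real.exp_le_exp.2 ?_)
  refine (norm_sum_le _ _).trans (Finset.sum_le_sum fun k _ => ?_)
  rw [norm_div, norm_pow, Complex.norm_natCast]
  gcongr

theorem norm_primaryFactor_sub_one_le (hm : 1 ≤ m) {u : ℂ} {R : ℝ} (hu : ‖u‖ ≤ R) :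
    ‖primaryFactor m u - 1‖ ≤ Real.exp (primaryExponent m R) * ‖u‖ ^ m := by
  have h := (convex_closedBall (0 : ℂ) ‖u‖).norm_image_sub_le_of_norm_hasDerivWithin_le
    (f := primaryFactor m) (C := ‖u‖ ^ (m - 1) * Real.exp (primaryExponent m R)) (x := 0) (y := u)
    (fun x _ => (hasDerivAt_primaryFactor hm x).hasDerivWithinAt) (fun x hx => ?_) (by simp)
    (by simp)
  · rw [primaryFactor_zero, sub_zero] at h
    refine h.trans (le_of_eq ?_)
    obtain ⟨l, rfl⟩ := Nat.exists_eq_add_of_le' hm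
    rw [Nat.add_sub_cancel, pow_succ]
    ring
  · have hx' : ‖x‖ ≤ ‖u‖ := by simpa using hx
    rw [norm_neg, norm_mul, norm_pow]
    gcongr
    exact norm_exp_primaryExponent_le (hx'.trans hu)

/-- The product `∏ⱼ E(w μⱼ)` of primary factors. -/
def primaryProd (m : ℕ) {n : ℕ} (μ : Fin n → ℂ) (w : ℂ) : ℂ := ∏ j, primaryFactor m (w * μ j)

variable {n : ℕ} {μ : Fin n → ℂ} {T C : ℝ}

theorem primaryProd_zero : primaryProd m μ 0 = 1 := by simp [primaryProd, primaryFactor_zero]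

/-- Uses $|\prod(1+a_j)-1|\le\exp(\sum|a_j|)-1$. The number of factors does not enter, which permits
the passage to infinite rank. -/
theorem norm_primaryProd_sub_one_le (hm : 1 ≤ m) (hT : ∑ j, ‖μ j‖ ^ m ≤ T) (hC : ∀ j, ‖μ j‖ ≤ C)
    {r : ℝ} {w : ℂ} (hw : ‖w‖ ≤ r) :
    ‖primaryProd m μ w - 1‖ ≤
      Real.exp (Real.exp (primaryExponent m (r * C)) * r ^ m * T) - 1 := by
  have h := Finset.univ.norm_prod_one_add_sub_one_le (fun j => primaryFactor m (w * μ j) - 1)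
  simp only [add_sub_cancel] at h
  refine h.trans (sub_le_sub_right (Real.exp_le_exp.2 ?_) _)
  have hr : 0 ≤ r := (norm_nonneg w).trans hw
  calc ∑ j, ‖primaryFactor m (w * μ j) - 1‖
      ≤ ∑ j, Real.exp (primaryExponent m (r * C)) * r ^ m * ‖μ j‖ ^ m := by
        refine Finset.sum_le_sum fun j _ => ?_
        refine (norm_primaryFactor_sub_one_le hm (R := r * C) ?_).trans ?_
        · rw [norm_mul]
          exact mul_le_mul hw (hC j) (norm_nonneg _) hr
        · rw [norm_mul, mul_pow, mul_assoc]
          gcongr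
    _ = Real.exp (primaryExponent m (r * C)) * r ^ m * ∑ j, ‖μ j‖ ^ m := by
        rw [Finset.mul_sum]
    _ ≤ _ := by gcongr

theorem hasDerivAt_primaryFactor_mul (hm : 1 ≤ m) {a w : ℂ} (hw : 1 - w * a ≠ 0) :
    HasDerivAt (fun w => primaryFactor m (w * a))
      (-(a ^ m * w ^ (m - 1) / (1 - w * a)) * primaryFactor m (w * a)) w := by
  have h := (hasDerivAt_primaryFactor hm (w * a)).comp w ((hasDerivAt_id w).mul_const a)
  refine h.congr_deriv ?_
  obtain ⟨l, rfl⟩ := Nat.exists_eq_add_of_le' hm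
  simp only [primaryFactor, Nat.add_sub_cancel]
  field_simp
  ring

/-- Expands the logarithmic derivative of one factor; the coefficient of $w^i$ carries the power
$i+1$, so after summing over the eigenvalues it becomes $\operatorname{trace}F^{i+1}$. -/
theorem hasSum_tail_geometric (hm : 1 ≤ m) {a w : ℂ} (hw : ‖w * a‖ < 1) :
    HasSum (fun i => (if m ≤ i + 1 then a ^ (i + 1) else 0) * w ^ i)
      (a ^ m * w ^ (m - 1) / (1 - w * a)) := by
  obtain ⟨l, rfl⟩ := Nat.exists_eq_add_of_le' hm
  have h := (hasSum_geometric_of_norm_lt_one hw).mul_left (a ^ (l + 1) * w ^ l)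
  rw [← hasSum_nat_add_iff' l]
  have h0 : ∑ i ∈ Finset.range l, (if l + 1 ≤ i + 1 then a ^ (i + 1) else 0) * w ^ i = 0 :=
    Finset.sum_eq_zero fun i hi => by
      rw [if_neg (by have := Finset.mem_range.1 hi; omega), zero_mul]
  rw [h0, sub_zero, Nat.add_sub_cancel]
  convert! h using 1
  ext i
  rw [if_pos (by omega)]
  ring

theorem hasDerivAt_primaryProd (hm : 1 ≤ m) {w : ℂ} (hw : ∀ j, 1 - w * μ j ≠ 0) :
    HasDerivAt (primaryProd m μ)
      (-(∑ j, μ j ^ m * w ^ (m - 1) / (1 - w * μ j)) * primaryProd m μ w) w := by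
  classical
  have h := HasDerivAt.fun_finsetProd (u := Finset.univ)
    (fun j _ => hasDerivAt_primaryFactor_mul hm (hw j))
  refine h.congr_deriv ?_
  rw [← Finset.sum_neg_distrib, Finset.sum_mul]
  refine Finset.sum_congr rfl fun j _ => ?_
  rw [smul_eq_mul, primaryProd, ← Finset.mul_prod_erase _ _ (Finset.mem_univ j)]
  ring

theorem differentiable_primaryProd (hm : 1 ≤ m) : Differentiable ℂ (primaryProd m μ) := by
  unfold primaryProd
  refine Differentiable.fun_finsetProd fun j _ => ?_
  have h : Differentiable ℂ (primaryFactor m) :=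
    fun u => (hasDerivAt_primaryFactor hm u).differentiableAt
  exact h.comp (differentiable_id.mul_const (μ j))

end PrimaryFactor

/-! ### Taylor coefficients from the logarithmic derivative -/

section DerivSeq

/-- The derivatives at `0` of the solution of `f' = -Q f`, `f 0 = 1` for `Q(w) = ∑ᵢ bᵢ w ^ i`. -/
def derivSeq (b : ℕ → ℂ) : ℕ → ℂ
  | 0 => 1
  | k + 1 => -∑ i : Fin (k + 1), (k.choose i : ℂ) * (i.1.factorial * b i) * derivSeq b (k - i)
decreasing_by omega

theorem derivSeq_zero (b : ℕ → ℂ) : derivSeq b 0 = 1 := by rw [derivSeq]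

theorem derivSeq_succ (b : ℕ → ℂ) (k : ℕ) : derivSeq b (k + 1) =
    -∑ i ∈ Finset.range (k + 1), (k.choose i : ℂ) * (i.factorial * b i) * derivSeq b (k - i) := by
  rw [derivSeq, Finset.sum_range]

/-- Each term is a polynomial in finitely many $b_i$, hence continuous in them. -/
theorem tendsto_derivSeq {α : Type*} {l : Filter α} {b : α → ℕ → ℂ} {b' : ℕ → ℂ}
    (h : ∀ i, Tendsto (fun a => b a i) l (𝓝 (b' i))) (k : ℕ) :
    Tendsto (fun a => derivSeq (b a) k) l (𝓝 (derivSeq b' k)) := by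
  induction k using Nat.strong_induction_on with
  | _ k ih =>
    cases k with
    | zero => simp only [derivSeq_zero]; exact tendsto_const_nhds
    | succ k =>
      simp only [derivSeq_succ]
      refine (tendsto_finsetSum _ fun i _ => ?_).neg
      exact (((h i).const_mul _).const_mul _).mul (ih (k - i) (by omega))

theorem derivSeq_scale (c : ℂ) (b : ℕ → ℂ) (k : ℕ) :
    derivSeq (fun i => c ^ (i + 1) * b i) k = c ^ k * derivSeq b k := by
  induction k using Nat.strong_induction_on with
  | _ k ih =>
    cases k with
    | zero => simp [derivSeq_zero]
    | succ k =>
      rw [derivSeq_succ, derivSeq_succ, mul_neg, Finset.mul_sum]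
      congr 1
      refine Finset.sum_congr rfl fun i hi => ?_
      have hi' := Finset.mem_range.1 hi
      rw [ih (k - i) (by omega), show c ^ (k + 1) = c ^ (i + 1) * c ^ (k - i) by
        rw [← pow_add]; congr 1; omega]
      ring

theorem iteratedDeriv_eq_of_hasSum {Q : ℂ → ℂ} {b : ℕ → ℂ} {δ : ℝ} (hδ : 0 < δ)
    (hQ : ∀ w, ‖w‖ < δ → HasSum (fun i => b i * w ^ i) (Q w)) :
    AnalyticAt ℂ Q 0 ∧ ∀ k, iteratedDeriv k Q 0 = k.factorial * b k := by
  have hp : HasFPowerSeriesAt Q (FormalMultilinearSeries.ofScalars ℂ b) 0 := by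
    rw [hasFPowerSeriesAt_iff]
    filter_upwards [Metric.ball_mem_nhds (0 : ℂ) hδ] with w hw
    rw [mem_ball_zero_iff] at hw
    simpa [FormalMultilinearSeries.coeff_ofScalars, mul_comm] using hQ w hw
  refine ⟨hp.analyticAt, fun k => ?_⟩
  have h := hp.analyticAt.hasFPowerSeriesAt.eq_formalMultilinearSeries hp
  have hk := congrArg (fun p => FormalMultilinearSeries.coeff p k) h
  simp only [FormalMultilinearSeries.coeff_ofScalars] at hk
  rw [← hk]
  have : (k.factorial : ℂ) ≠ 0 := by exact_mod_cast k.factorial_ne_zero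
  field_simp

/-- Leibniz' rule for $f'=-Qf$ at $0$ is exactly the recursion defining `derivSeq`. -/
theorem iteratedDeriv_eq_derivSeq {f Q : ℂ → ℂ} {b : ℕ → ℂ} {δ : ℝ} (hδ : 0 < δ) (h0 : f 0 = 1)
    (hf : ∀ w, ‖w‖ < δ → HasDerivAt f (-Q w * f w) w)
    (hQ : ∀ w, ‖w‖ < δ → HasSum (fun i => b i * w ^ i) (Q w)) (k : ℕ) :
    iteratedDeriv k f 0 = derivSeq b k := by
  obtain ⟨hQa, hQd⟩ := iteratedDeriv_eq_of_hasSum hδ hQ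
  have hball : ∀ᶠ w in 𝓝 (0 : ℂ), ‖w‖ < δ := by
    filter_upwards [Metric.ball_mem_nhds (0 : ℂ) hδ] with w hw
    simpa using hw
  have hfa : AnalyticAt ℂ f 0 := by
    refine DifferentiableOn.analyticAt (s := Metric.ball 0 δ) (fun w hw => ?_)
      (Metric.ball_mem_nhds _ hδ)
    exact (hf w (by simpa using hw)).differentiableAt.differentiableWithinAt
  have hderiv : deriv f =ᶠ[𝓝 0] -(Q * f) := by
    filter_upwards [hball] with w hw
    rw [(hf w hw).deriv]
    simp
  induction k using Nat.strong_induction_on with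
  | _ k ih =>
    cases k with
    | zero => simp [derivSeq_zero, h0]
    | succ k =>
      rw [iteratedDeriv_succ', hderiv.iteratedDeriv_eq, iteratedDeriv_neg,
        iteratedDeriv_mul hQa.contDiffAt hfa.contDiffAt, derivSeq_succ]
      congr 1
      refine Finset.sum_congr rfl fun i hi => ?_
      rw [hQd, ih (k - i) (by omega)]

/-- The equation is needed only near $0$ to identify the coefficients; the series converges on the
whole disc where $f$ is holomorphic. -/
theorem hasSum_derivSeq {f Q : ℂ → ℂ} {b : ℕ → ℂ} {δ : ℝ} (hδ : 0 < δ) (h0 : f 0 = 1)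
    (hf : ∀ w, ‖w‖ < δ → HasDerivAt f (-Q w * f w) w)
    (hQ : ∀ w, ‖w‖ < δ → HasSum (fun i => b i * w ^ i) (Q w)) {r : ℝ}
    (hd : DifferentiableOn ℂ f (Metric.ball 0 r)) {w : ℂ} (hw : ‖w‖ < r) :
    HasSum (fun k : ℕ => (k.factorial : ℂ)⁻¹ * derivSeq b k * w ^ k) (f w) := by
  have h := Complex.hasSum_taylorSeries_on_ball hd (z := w) (by simpa using hw)
  convert! h using 1
  ext k
  rw [iteratedDeriv_eq_derivSeq hδ h0 hf hQ, smul_eq_mul, smul_eq_mul, sub_zero]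
  ring

theorem norm_derivSeq_le {f Q : ℂ → ℂ} {b : ℕ → ℂ} {δ : ℝ} (hδ : 0 < δ) (h0 : f 0 = 1)
    (hf : ∀ w, ‖w‖ < δ → HasDerivAt f (-Q w * f w) w)
    (hQ : ∀ w, ‖w‖ < δ → HasSum (fun i => b i * w ^ i) (Q w)) (hd : Differentiable ℂ f)
    {R M : ℝ} (hR : 0 < R) (hM : ∀ w, ‖w‖ ≤ R → ‖f w‖ ≤ M) (k : ℕ) :
    ‖derivSeq b k‖ ≤ k.factorial * M / R ^ k := by
  rw [← iteratedDeriv_eq_derivSeq hδ h0 hf hQ]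
  refine Complex.norm_iteratedDeriv_le_of_forall_mem_sphere_norm_le k hR hd.diffContOnCl
    fun z hz => hM z ?_
  exact (mem_sphere_zero_iff_norm.1 hz).le

end DerivSeq

/-! ### The regularized determinant as an entire function -/

section RegularizedDeterminant

/-- The coefficients of `∑_{n ≥ m} trace (A ^ n) w ^ (n - 1)`. -/
def traceSeq (m : ℕ) (A : H →L[ℂ] H) (i : ℕ) : ℂ :=
  if m ≤ i + 1 then opTrace (A ^ (i + 1)) else 0

/-- The Taylor series of `z ↦ det_m (1 - z A)`. -/
def detSeries (m : ℕ) (A : H →L[ℂ] H) (z : ℂ) : ℂ :=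
  ∑' k : ℕ, (k.factorial : ℂ)⁻¹ * derivSeq (traceSeq m A) k * z ^ k

/-- A bound for `|det_m (1 - z A)|` on the disc of radius `r`. -/
def detBound (m : ℕ) (T C r : ℝ) : ℝ :=
  Real.exp (Real.exp (primaryExponent m (r * C)) * r ^ m * T)

variable {A F : H →L[ℂ] H} {m : ℕ} {T C : ℝ}

theorem detSeries_smul (z : ℂ) : detSeries m (z • A) 1 = detSeries m A z := by
  have h : traceSeq m (z • A) = fun i => z ^ (i + 1) * traceSeq m A i := by
    ext i
    rw [traceSeq, traceSeq]
    split_ifs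
    · rw [smul_pow, opTrace_smul]
    · rw [mul_zero]
  rw [detSeries, detSeries, h]
  refine tsum_congr fun k => ?_
  rw [derivSeq_scale, one_pow]
  ring

/-- The $\mu_j^m$ are diagonal entries of $F^m$ in an orthonormal family, which gives the bound by
the trace norm. Each $\mu_j$ has $|\mu_j|\le1$ or $|\mu_j|\le|\mu_j|^m\le T$, hence the role of
$T+1\le C$. -/
theorem IsFiniteRank.exists_primaryProd (hm : 1 ≤ m) (hF : IsFiniteRank F) (hT0 : 0 ≤ T)
    (hT : schattenNorm 1 (F ^ m) ≤ ENNReal.ofReal T) (hC : T + 1 ≤ C) :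
    ∃ (n : ℕ) (μ : Fin n → ℂ), ∑ j, ‖μ j‖ ^ m ≤ T ∧ (∀ j, ‖μ j‖ ≤ C) ∧
      (∀ i, traceSeq m F i = ∑ j, if m ≤ i + 1 then μ j ^ (i + 1) else 0) ∧
      finiteRankRegDet m F = primaryProd m μ 1 := by
  obtain ⟨n, e, μ, he, hpow, hdet, htr⟩ := hF.exists_triangulation
  have hsum : ∑ j, ‖μ j‖ ^ m ≤ T := by
    have h := (tsum_enorm_inner_le_schattenNorm (F ^ m) he he).trans hT
    rw [tsum_fintype] at h
    simp only [hpow m hm, ← ofReal_norm] at h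
    rw [← ENNReal.ofReal_sum_of_nonneg (fun _ _ => norm_nonneg _)] at h
    rw [ENNReal.ofReal_le_ofReal_iff hT0] at h
    simpa only [norm_pow] using h
  refine ⟨n, μ, hsum, fun j => ?_, fun i => ?_, ?_⟩
  · have h1 : ‖μ j‖ ^ m ≤ T := (Finset.single_le_sum (f := fun j => ‖μ j‖ ^ m)
      (fun _ _ => by positivity) (Finset.mem_univ j)).trans hsum
    rcases le_total ‖μ j‖ 1 with h | h
    · linarith
    · have := le_self_pow₀ h (by omega : m ≠ 0)
      linarith
  · rw [traceSeq]
    split_ifs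
    · exact htr _ (by omega)
    · simp
  · rw [finiteRankRegDet, hdet, primaryProd]
    simp only [one_mul, primaryFactor]
    rw [Finset.prod_mul_distrib, ← Complex.exp_sum]
    congr 2
    simp only [primaryExponent]
    rw [Finset.sum_comm]
    refine Finset.sum_congr rfl fun k hk => ?_
    rw [htr k (Finset.mem_Ico.1 hk).1, Finset.mul_sum]
    exact Finset.sum_congr rfl fun j _ => by ring

theorem one_le_detBound {r : ℝ} (hT0 : 0 ≤ T) (hr : 0 ≤ r) : 1 ≤ detBound m T C r :=
  Real.one_le_exp (by positivity)

/-- `det_m (1 - w F)` for `F` of finite rank, with bounds depending only on the trace norm of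
`F ^ m`. -/
theorem IsFiniteRank.detSeries_bounds (hm : 1 ≤ m) (hF : IsFiniteRank F) (hT0 : 0 ≤ T)
    (hT : schattenNorm 1 (F ^ m) ≤ ENNReal.ofReal T) (hC : T + 1 ≤ C) :
    finiteRankRegDet m F = detSeries m F 1 ∧
    (∀ r z, ‖z‖ ≤ r → ‖detSeries m F z - 1‖ ≤ detBound m T C r - 1) ∧
    (∀ R, 0 < R → ∀ k : ℕ,
      ‖derivSeq (traceSeq m F) k‖ ≤ k.factorial * detBound m T C R / R ^ k) ∧
    ∀ i, ‖traceSeq m F i‖ ≤ T * C ^ i := by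
  obtain ⟨n, μ, hsum, hμ, htr, hdet⟩ := hF.exists_primaryProd hm hT0 hT hC
  have hC1 : 1 ≤ C := by linarith
  have hC0 : 0 < C := by linarith
  have hlt : ∀ w : ℂ, ‖w‖ < C⁻¹ → ∀ j, ‖w * μ j‖ < 1 := by
    intro w hw j
    rw [norm_mul]
    calc ‖w‖ * ‖μ j‖ ≤ ‖w‖ * C := by gcongr; exact hμ j
      _ < C⁻¹ * C := by gcongr
      _ = 1 := inv_mul_cancel₀ hC0.ne'
  have hQ : ∀ w : ℂ, ‖w‖ < C⁻¹ → HasSum (fun i => traceSeq m F i * w ^ i)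
      (∑ j, μ j ^ m * w ^ (m - 1) / (1 - w * μ j)) := by
    intro w hw
    have h := hasSum_sum (s := Finset.univ)
      (fun j _ => hasSum_tail_geometric hm (hlt w hw j))
    convert! h using 1
    ext i
    rw [htr, Finset.sum_mul]
  have hf : ∀ w : ℂ, ‖w‖ < C⁻¹ → HasDerivAt (primaryProd m μ)
      (-(∑ j, μ j ^ m * w ^ (m - 1) / (1 - w * μ j)) * primaryProd m μ w) w := by
    intro w hw
    refine hasDerivAt_primaryProd hm fun j h => ?_
    have := hlt w hw j
    rw [← sub_eq_zero.1 h, norm_one] at this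
    exact lt_irrefl _ this
  have hd : Differentiable ℂ (primaryProd m μ) := differentiable_primaryProd hm
  -- On the disc of radius $C^{-1}$ no $1-w\mu_j$ vanishes, so the differential equation holds
  -- there; the product is entire, so its Taylor series represents it everywhere.
  have heq : ∀ w, detSeries m F w = primaryProd m μ w := fun w =>
    (hasSum_derivSeq (inv_pos.2 hC0) primaryProd_zero hf hQ hd.differentiableOn
      (lt_add_one ‖w‖)).tsum_eq
  have hb : ∀ r z, ‖z‖ ≤ r → ‖primaryProd m μ z - 1‖ ≤ detBound m T C r - 1 := fun r z hz =>
    norm_primaryProd_sub_one_le hm hsum hμ hz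
  refine ⟨by rw [heq, hdet], fun r z hz => by rw [heq]; exact hb r z hz, fun R hR k => ?_,
    fun i => ?_⟩
  · refine norm_derivSeq_le (inv_pos.2 hC0) primaryProd_zero hf hQ hd hR (fun w hw => ?_) k
    have h1 := hb R w hw
    have h2 := norm_sub_norm_le (primaryProd m μ w) 1
    rw [norm_one] at h2
    linarith
  · rw [htr]
    split_ifs with h
    · calc ‖∑ j, μ j ^ (i + 1)‖ ≤ ∑ j, ‖μ j‖ ^ m * C ^ i := by
            refine (norm_sum_le _ _).trans (Finset.sum_le_sum fun j _ => ?_)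
            rw [norm_pow, show i + 1 = m + (i + 1 - m) by omega, pow_add]
            gcongr
            calc ‖μ j‖ ^ (i + 1 - m) ≤ C ^ (i + 1 - m) := by gcongr; exact hμ j
              _ ≤ C ^ i := pow_le_pow_right₀ hC1 (by omega)
        _ = (∑ j, ‖μ j‖ ^ m) * C ^ i := by rw [Finset.sum_mul]
        _ ≤ T * C ^ i := by gcongr
    · simp only [Finset.sum_const_zero, norm_zero]
      positivity

theorem norm_detSeries_term_le {b : ℕ → ℂ} {R M : ℝ} {z : ℂ} {k : ℕ}
    (h : ‖derivSeq b k‖ ≤ k.factorial * M / R ^ k) :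
    ‖(k.factorial : ℂ)⁻¹ * derivSeq b k * z ^ k‖ ≤ M * (‖z‖ / R) ^ k := by
  have hk : (0 : ℝ) < k.factorial := by exact_mod_cast k.factorial_pos
  rw [norm_mul, norm_mul, norm_inv, Complex.norm_natCast, norm_pow]
  calc (k.factorial : ℝ)⁻¹ * ‖derivSeq b k‖ * ‖z‖ ^ k
      ≤ (k.factorial : ℝ)⁻¹ * (k.factorial * M / R ^ k) * ‖z‖ ^ k := by gcongr
    _ = M * (‖z‖ / R) ^ k := by rw [div_pow]; field_simp

theorem eventually_finiteRank_trace_le (hm : 1 ≤ m) (hA : MemSchatten m A)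
    (hT : schattenNorm 1 (A ^ m) < ENNReal.ofReal T) :
    ∀ᶠ F in finiteRankNhds m A, IsFiniteRank F ∧ schattenNorm 1 (F ^ m) ≤ ENNReal.ofReal T := by
  refine (eventually_isFiniteRank m A).and ?_
  filter_upwards [eventually_schattenNorm_pow_le hm hA (tsub_pos_of_lt hT)] with F hF
  rwa [add_tsub_cancel_of_le hT.le] at hF

theorem tendsto_traceSeq (hm : 1 ≤ m) (hA : MemSchatten m A) (i : ℕ) :
    Tendsto (fun F => traceSeq m F i) (finiteRankNhds m A) (𝓝 (traceSeq m A i)) := by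
  unfold traceSeq
  split_ifs with h
  · exact tendsto_opTrace_pow hm hA h
  · exact tendsto_const_nhds

theorem pos_of_lt_ofReal {x : ℝ≥0∞} (hT : x < ENNReal.ofReal T) : 0 < T :=
  ENNReal.ofReal_pos.1 (zero_le.trans_lt hT)

/-- Obtained as a limit of eigenvalue bounds. The direct estimate $\|A^m\|_1\|A\|^{i+1-m}$ would
involve $\|A\|$, which $\|A^m\|_1$ does not control. -/
theorem norm_traceSeq_le (hm : 1 ≤ m) (hA : MemSchatten m A)
    (hT : schattenNorm 1 (A ^ m) < ENNReal.ofReal T) (hC : T + 1 ≤ C) (i : ℕ) :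
    ‖traceSeq m A i‖ ≤ T * C ^ i := by
  have := finiteRankNhds_neBot (by exact_mod_cast hm) hA
  refine le_of_tendsto (tendsto_traceSeq hm hA i).norm ?_
  filter_upwards [eventually_finiteRank_trace_le hm hA hT] with F hF
  exact (hF.1.detSeries_bounds hm (pos_of_lt_ofReal hT).le hF.2 hC).2.2.2 i

theorem norm_derivSeq_traceSeq_le (hm : 1 ≤ m) (hA : MemSchatten m A)
    (hT : schattenNorm 1 (A ^ m) < ENNReal.ofReal T) (hC : T + 1 ≤ C) {R : ℝ} (hR : 0 < R) (k : ℕ) :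
    ‖derivSeq (traceSeq m A) k‖ ≤ k.factorial * detBound m T C R / R ^ k := by
  have := finiteRankNhds_neBot (by exact_mod_cast hm) hA
  refine le_of_tendsto (tendsto_derivSeq (fun i => tendsto_traceSeq hm hA i) k).norm ?_
  filter_upwards [eventually_finiteRank_trace_le hm hA hT] with F hF
  exact (hF.1.detSeries_bounds hm (pos_of_lt_ofReal hT).le hF.2 hC).2.2.1 R hR k

theorem exists_trace_bound (hm : 1 ≤ m) (hA : MemSchatten m A) :
    ∃ T, schattenNorm 1 (A ^ m) < ENNReal.ofReal T := by
  have h := memSchatten_one_pow hm hA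
  refine ⟨(schattenNorm 1 (A ^ m)).toReal + 1, ?_⟩
  rw [ENNReal.ofReal_add ENNReal.toReal_nonneg zero_le_one, ENNReal.ofReal_toReal (ne_of_lt h),
    ENNReal.ofReal_one]
  exact ENNReal.lt_add_right (ne_of_lt h) one_ne_zero

theorem tendsto_detSeries (hm : 1 ≤ m) (hA : MemSchatten m A) (z : ℂ) :
    Tendsto (fun F => detSeries m F z) (finiteRankNhds m A) (𝓝 (detSeries m A z)) := by
  obtain ⟨T, hT⟩ := exists_trace_bound hm hA
  -- Cauchy's estimate at this radius gives a geometric majorant of ratio below $1/2$, uniform in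
  -- $F$.
  have hR : 0 < 2 * (‖z‖ + 1) := by positivity
  refine tendsto_tsum_of_dominated_convergence
    (bound := fun k => detBound m T (T + 1) (2 * (‖z‖ + 1)) * (‖z‖ / (2 * (‖z‖ + 1))) ^ k) ?_
    (fun k => ?_) ?_
  · refine (summable_geometric_of_lt_one (by positivity) ?_).mul_left _
    rw [div_lt_one hR]
    linarith [norm_nonneg z]
  · exact ((tendsto_derivSeq (fun i => tendsto_traceSeq hm hA i) k).const_mul _).mul_const _
  · filter_upwards [eventually_finiteRank_trace_le hm hA hT] with F hF k
    exact norm_detSeries_term_le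
      ((hF.1.detSeries_bounds hm (pos_of_lt_ofReal hT).le hF.2 le_rfl).2.2.1 _ hR k)

theorem norm_detSeries_sub_one_le (hm : 1 ≤ m) (hA : MemSchatten m A)
    (hT : schattenNorm 1 (A ^ m) < ENNReal.ofReal T) (hC : T + 1 ≤ C) {r : ℝ} {z : ℂ}
    (hz : ‖z‖ ≤ r) : ‖detSeries m A z - 1‖ ≤ detBound m T C r - 1 := by
  have := finiteRankNhds_neBot (by exact_mod_cast hm) hA
  refine le_of_tendsto ((tendsto_detSeries hm hA z).sub_const 1).norm ?_
  filter_upwards [eventually_finiteRank_trace_le hm hA hT] with F hF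
  exact (hF.1.detSeries_bounds hm (pos_of_lt_ofReal hT).le hF.2 hC).2.1 r z hz

theorem differentiable_detSeries (hm : 1 ≤ m) (hA : MemSchatten m A) :
    Differentiable ℂ (detSeries m A) := by
  obtain ⟨T, hT⟩ := exists_trace_bound hm hA
  intro z
  have hr : 0 < ‖z‖ + 1 := by positivity
  have hR : 0 < 2 * (‖z‖ + 1) := by positivity
  have hd : DifferentiableOn ℂ (detSeries m A) (Metric.ball 0 (‖z‖ + 1)) := by
    refine Complex.differentiableOn_tsum_of_summable_norm
      (u := fun k => detBound m T (T + 1) (2 * (‖z‖ + 1)) * (1 / 2) ^ k)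
      ((summable_geometric_of_lt_one (by norm_num) (by norm_num)).mul_left _)
      (fun k => by fun_prop) Metric.isOpen_ball fun k w hw => ?_
    refine (norm_detSeries_term_le (norm_derivSeq_traceSeq_le hm hA hT le_rfl hR k)).trans ?_
    have hw' : ‖w‖ < ‖z‖ + 1 := by simpa using hw
    have := one_le_detBound (m := m) (C := T + 1) (pos_of_lt_ofReal hT).le hR.le
    have h2 : ‖w‖ / (2 * (‖z‖ + 1)) ≤ 1 / 2 := by
      rw [div_le_div_iff₀ hR (by norm_num)]
      linarith
    exact mul_le_mul_of_nonneg_left (pow_le_pow_left₀ (by positivity) h2 k) (by linarith)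
  exact hd.differentiableAt (Metric.isOpen_ball.mem_nhds (by simp))

/-- The regularized determinant is the sum of its Taylor series. -/
theorem regDet_smul_eq_detSeries (hm : 1 ≤ m) (hA : MemSchatten m A) (z : ℂ) :
    regDet m (z • A) = detSeries m A z := by
  have hp : (1 : ℝ) ≤ m := by exact_mod_cast hm
  have hzA := hA.smul z hp
  have := finiteRankNhds_neBot hp hzA
  rw [← detSeries_smul]
  refine Tendsto.limUnder_eq ((tendsto_detSeries hm hzA 1).congr' ?_)
  obtain ⟨T, hT⟩ := exists_trace_bound hm hzA
  filter_upwards [eventually_finiteRank_trace_le hm hzA hT] with F hF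
  exact (hF.1.detSeries_bounds hm (pos_of_lt_ofReal hT).le hF.2 le_rfl).1.symm

theorem norm_traceSeq_mul_pow_le (hC : 1 ≤ C) {b : ℕ → ℂ} (hb : ∀ i, ‖b i‖ ≤ T * C ^ i) {w : ℂ}
    (hw : ‖w‖ < 1 / (2 * C)) (i : ℕ) : ‖b i * w ^ i‖ ≤ T * (1 / 2) ^ i := by
  have hC0 : 0 < C := by linarith
  rw [norm_mul, norm_pow]
  have hT : 0 ≤ T * C ^ i := (norm_nonneg _).trans (hb i)
  calc ‖b i‖ * ‖w‖ ^ i ≤ T * C ^ i * (1 / (2 * C)) ^ i := by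
        gcongr
        exact hb i
    _ = T * (1 / 2) ^ i := by rw [mul_assoc, ← mul_pow]; congr 2; field_simp

theorem norm_log_term_le (hC : 1 ≤ C) {b : ℕ → ℂ} (hb : ∀ i, ‖b i‖ ≤ T * C ^ i) {w : ℂ}
    (hw : ‖w‖ < 1 / (2 * C)) (i : ℕ) :
    ‖w ^ (i + 1) / ((i : ℂ) + 1) * b i‖ ≤ T * (1 / 2) ^ i := by
  have h := norm_traceSeq_mul_pow_le hC hb hw i
  refine le_trans ?_ h
  have hw1 : ‖w‖ ≤ 1 := by
    refine hw.le.trans ?_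
    rw [div_le_one (by linarith)]
    linarith
  have hi : ‖(i : ℂ) + 1‖ = i + 1 := by
    rw [← Nat.cast_add_one, Complex.norm_natCast, Nat.cast_add_one]
  rw [norm_mul, norm_div, norm_pow, hi, norm_mul, norm_pow, mul_comm ‖b i‖]
  gcongr
  rw [pow_succ, mul_div_assoc]
  refine mul_le_of_le_one_right (by positivity) ?_
  rw [div_le_one (by positivity)]
  linarith [(Nat.cast_nonneg i : (0 : ℝ) ≤ i)]

/-- Near `0`, `det_m (1 - w A) = exp (- ∑_{n ≥ m} trace (A ^ n) w ^ n / n)`. -/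
theorem detSeries_eq_exp (hm : 1 ≤ m) (hA : MemSchatten m A)
    (hT : schattenNorm 1 (A ^ m) < ENNReal.ofReal T) (hC : T + 1 ≤ C) {z : ℂ}
    (hz : ‖z‖ < 1 / (2 * C)) :
    detSeries m A z = Complex.exp (-∑' i : ℕ, z ^ (i + 1) / ((i : ℂ) + 1) * traceSeq m A i) := by
  have hT0 := pos_of_lt_ofReal hT
  have hC1 : 1 ≤ C := by linarith
  have hδ : 0 < 1 / (2 * C) := by positivity
  have hb := norm_traceSeq_le hm hA hT hC
  have hu : Summable fun i : ℕ => T * (1 / 2 : ℝ) ^ i :=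
    (summable_geometric_of_lt_one (by norm_num) (by norm_num)).mul_left _
  have hQ : ∀ w : ℂ, ‖w‖ < 1 / (2 * C) → HasSum (fun i => traceSeq m A i * w ^ i)
      (∑' i, traceSeq m A i * w ^ i) := fun w hw =>
    (hu.of_norm_bounded (norm_traceSeq_mul_pow_le hC1 hb hw)).hasSum
  have hg : ∀ w : ℂ, ‖w‖ < 1 / (2 * C) → HasDerivAt
      (fun w : ℂ => ∑' i : ℕ, w ^ (i + 1) / ((i : ℂ) + 1) * traceSeq m A i)
      (∑' i, traceSeq m A i * w ^ i) w := by
    intro w hw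
    refine hasDerivAt_tsum_of_isPreconnected (u := fun i : ℕ => T * (1 / 2 : ℝ) ^ i)
      (g := fun (i : ℕ) (w : ℂ) => w ^ (i + 1) / ((i : ℂ) + 1) * traceSeq m A i)
      (g' := fun i w => traceSeq m A i * w ^ i) (y₀ := 0) hu
      (t := Metric.ball (0 : ℂ) (1 / (2 * C))) Metric.isOpen_ball
      (convex_ball (0 : ℂ) _).isPreconnected (fun i y _ => ?_) (fun i y hy => ?_)
      (Metric.mem_ball_self hδ) ?_ (mem_ball_zero_iff.2 hw)
    · have hi : ((i : ℂ) + 1) ≠ 0 := by exact_mod_cast i.succ_ne_zero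
      refine (((hasDerivAt_pow (i + 1) y).div_const ((i : ℂ) + 1)).mul_const
        (traceSeq m A i)).congr_deriv ?_
      push_cast
      field_simp
    · exact norm_traceSeq_mul_pow_le hC1 hb (mem_ball_zero_iff.1 hy) i
    · simp
  have hf : ∀ w : ℂ, ‖w‖ < 1 / (2 * C) → HasDerivAt
      (fun w : ℂ => Complex.exp (-∑' i : ℕ, w ^ (i + 1) / ((i : ℂ) + 1) * traceSeq m A i))
      (-(∑' i, traceSeq m A i * w ^ i) *
        Complex.exp (-∑' i : ℕ, w ^ (i + 1) / ((i : ℂ) + 1) * traceSeq m A i)) w := fun w hw =>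
    (hg w hw).neg.cexp.congr_deriv (mul_comm _ _)
  -- The exponential solves the same equation with the same $Q$ and value $1$ at $0$, so it has the
  -- Taylor series that defines `detSeries`.
  exact (hasSum_derivSeq hδ (by simp) hf hQ
    (fun w hw => (hf w (mem_ball_zero_iff.1 hw)).differentiableAt.differentiableWithinAt) hz).tsum_eq

end RegularizedDeterminant

/-! ### Locally uniform products of entire functions -/

section Products

/-- On every disc the functions `ψ ν - 1` are dominated by a summable sequence. -/
def IsLocallyDominated (ψ : ℕ → ℂ → ℂ) : Prop :=
  ∀ r : ℝ, ∃ u : ℕ → ℝ, Summable u ∧ ∀ ν z, ‖z‖ ≤ r → ‖ψ ν z - 1‖ ≤ u ν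

namespace IsLocallyDominated

variable {ψ : ℕ → ℂ → ℂ}

theorem comp_injective (h : IsLocallyDominated ψ) {g : ℕ → ℕ} (hg : Function.Injective g) :
    IsLocallyDominated fun ν => ψ (g ν) := fun r => by
  obtain ⟨u, hu, hb⟩ := h r
  exact ⟨u ∘ g, hu.comp_injective hg, fun ν z hz => hb (g ν) z hz⟩

theorem exists_isCompact_bound (h : IsLocallyDominated ψ) {K : Set ℂ} (hK : IsCompact K) :
    ∃ u : ℕ → ℝ, Summable u ∧ ∀ ν, ∀ z ∈ K, ‖ψ ν z - 1‖ ≤ u ν := by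
  obtain ⟨r, hr⟩ := hK.isBounded.exists_norm_le
  obtain ⟨u, hu, hb⟩ := h r
  exact ⟨u, hu, fun ν z hz => hb ν z (hr z hz)⟩

theorem summableLocallyUniformlyOn (h : IsLocallyDominated ψ) :
    SummableLocallyUniformlyOn (fun ν z => ‖ψ ν z - 1‖) Set.univ := by
  refine SummableLocallyUniformlyOn_of_locally_bounded isOpen_univ fun K _ hK => ?_
  obtain ⟨u, hu, hb⟩ := h.exists_isCompact_bound hK
  exact ⟨u, hu, fun ν z hz => by rw [norm_norm]; exact hb ν z hz⟩

theorem summable_norm (h : IsLocallyDominated ψ) (z : ℂ) : Summable fun ν => ‖ψ ν z - 1‖ := by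
  obtain ⟨u, hu, hb⟩ := h ‖z‖
  exact hu.of_nonneg_of_le (fun _ => norm_nonneg _) fun ν => hb ν z le_rfl

theorem multipliable (h : IsLocallyDominated ψ) (z : ℂ) : Multipliable fun ν => ψ ν z := by
  simpa using multipliable_one_add_of_summable (h.summable_norm z)

theorem tprod_ne_zero_iff (h : IsLocallyDominated ψ) (z : ℂ) :
    ∏' ν, ψ ν z ≠ 0 ↔ ∀ ν, ψ ν z ≠ 0 := by
  constructor
  · intro hz ν hν
    exact hz (tprod_of_exists_eq_zero ⟨ν, hν⟩)
  · intro hz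
    simpa using tprod_one_add_ne_zero_of_summable (f := fun ν => ψ ν z - 1) (by simpa using hz)
      (h.summable_norm z)

theorem hasProdLocallyUniformlyOn (h : IsLocallyDominated ψ) (hψ : ∀ ν, Continuous (ψ ν)) :
    HasProdLocallyUniformlyOn ψ (fun z => ∏' ν, ψ ν z) Set.univ := by
  refine hasProdLocallyUniformlyOn_of_forall_compact isOpen_univ fun K _ hK => ?_
  obtain ⟨u, hu, hb⟩ := h.exists_isCompact_bound hK
  simpa using hu.hasProdUniformlyOn_one_add (f := fun ν z => ψ ν z - 1) hK
    (Eventually.of_forall hb) (fun ν => ((hψ ν).sub continuous_const).continuousOn)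

theorem differentiable_tprod (h : IsLocallyDominated ψ) (hψ : ∀ ν, Differentiable ℂ (ψ ν)) :
    Differentiable ℂ fun z => ∏' ν, ψ ν z := by
  have h1 := h.hasProdLocallyUniformlyOn fun ν => (hψ ν).continuous
  rw [hasProdLocallyUniformlyOn_iff_tendstoLocallyUniformlyOn] at h1
  rw [← differentiableOn_univ]
  refine h1.differentiableOn (Eventually.of_forall fun s => ?_) isOpen_univ
  exact (Differentiable.fun_finsetProd fun ν _ => hψ ν).differentiableOn

/-- The exponents `-1, 1, -1, …` of the factors of the zeta function. -/
theorem zpow_even (ν : ℕ) (x : ℂ) : x ^ ((-1 : ℤ) ^ (2 * ν + 1)) = x⁻¹ := by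
  rw [pow_succ, pow_mul]; simp

theorem zpow_odd (ν : ℕ) (x : ℂ) : x ^ ((-1 : ℤ) ^ (2 * ν + 1 + 1)) = x := by
  rw [show 2 * ν + 1 + 1 = 2 * (ν + 1) by ring, pow_mul]; simp

theorem tprod_zpow (h : IsLocallyDominated ψ) {z : ℂ} (hz : ∀ ν, ψ (2 * ν) z ≠ 0) :
    ∏' ν, ψ ν z ^ ((-1 : ℤ) ^ (ν + 1)) = (∏' ν, ψ (2 * ν + 1) z) / ∏' ν, ψ (2 * ν) z := by
  have he := h.comp_injective (g := fun ν => 2 * ν) (fun a b hab => by simpa using hab)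
  have ho := h.comp_injective (g := fun ν => 2 * ν + 1) (fun a b hab => by simpa using hab)
  have h1 := (he.multipliable z).hasProd.inv₀ ((he.tprod_ne_zero_iff z).2 hz)
  have h2 := (ho.multipliable z).hasProd
  have h3 := HasProd.even_mul_odd (f := fun ν => ψ ν z ^ ((-1 : ℤ) ^ (ν + 1)))
    (by simpa only [zpow_even] using h1) (by simpa only [zpow_odd] using h2)
  rw [h3.tprod_eq, div_eq_inv_mul]

theorem multipliableLocallyUniformlyOn_zpow (h : IsLocallyDominated ψ)
    (hψ : ∀ ν, Continuous (ψ ν)) {U : Set ℂ} (hU : IsOpen U)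
    (hU0 : ∀ z ∈ U, ∀ ν, ψ (2 * ν) z ≠ 0) :
    MultipliableLocallyUniformlyOn (fun ν z => ψ ν z ^ ((-1 : ℤ) ^ (ν + 1))) U := by
  refine HasProdLocallyUniformlyOn.multipliableLocallyUniformlyOn
    (g := fun z => ∏' ν, ψ ν z ^ ((-1 : ℤ) ^ (ν + 1)))
    (hasProdLocallyUniformlyOn_of_forall_compact hU fun K hKU hK => ?_)
  obtain ⟨u, hu, hb⟩ := h.exists_isCompact_bound hK
  -- If $|\psi-1|<1/2$ then $|\psi|\ge1/2$ and $|\psi^{-1}-1|\le2|\psi-1|$; this holds for all but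
  -- finitely many $\nu$.
  have key := (hu.mul_left 2).hasProdUniformlyOn_one_add
    (f := fun ν z => ψ ν z ^ ((-1 : ℤ) ^ (ν + 1)) - 1) hK ?_ fun ν => ?_
  · simpa using key
  · have hsmall : ∀ᶠ ν in cofinite, u ν < 1 / 2 :=
      hu.tendsto_cofinite_zero.eventually (gt_mem_nhds (by norm_num))
    filter_upwards [hsmall] with ν hν z hz
    have hbz := hb ν z hz
    obtain ⟨k, rfl | rfl⟩ := Nat.even_or_odd' ν
    · have hne := hU0 z (hKU hz) k
      have h1 := norm_sub_norm_le (1 : ℂ) (1 - ψ (2 * k) z)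
      rw [norm_one, sub_sub_cancel, norm_sub_rev] at h1
      have h2 : 1 / 2 ≤ ‖ψ (2 * k) z‖ := by linarith
      rw [zpow_even, show (ψ (2 * k) z)⁻¹ - 1 = -(ψ (2 * k) z - 1) / ψ (2 * k) z by
        field_simp; ring, norm_div, norm_neg, div_le_iff₀ (by linarith)]
      nlinarith [norm_nonneg (ψ (2 * k) z - 1)]
    · rw [zpow_odd]
      linarith [norm_nonneg (ψ (2 * k + 1) z - 1)]
  · refine ContinuousOn.sub ?_ continuousOn_const
    obtain ⟨k, rfl | rfl⟩ := Nat.even_or_odd' ν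
    · simp only [zpow_even]
      exact (hψ _).continuousOn.inv₀ fun z hz => hU0 z (hKU hz) k
    · simp only [zpow_odd]
      exact (hψ _).continuousOn

/-- Turns infinitely many conditions into the nonvanishing of one entire function, so that the set
is open with discrete complement. -/
theorem setOf_eq_tprod_ne_zero (h : IsLocallyDominated ψ) :
    {z | ∀ ν, ψ (2 * ν) z ≠ 0} = {z | ∏' ν, ψ (2 * ν) z ≠ 0} := by
  ext z
  exact ((h.comp_injective (g := fun ν => 2 * ν)
    (fun a b hab => by simpa using hab)).tprod_ne_zero_iff z).symm

end IsLocallyDominated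

theorem setOf_ne_zero_mem_codiscrete {f : ℂ → ℂ} (hf : Differentiable ℂ f) {x : ℂ} (hx : f x ≠ 0) :
    {z | f z ≠ 0} ∈ codiscrete ℂ :=
  AnalyticOnNhd.preimage_zero_mem_codiscrete (fun z _ => hf.analyticAt z) hx

end Products

/-! ### Continuation of the zeta function by the identity theorem -/

section Zeta

variable {Z : ℕ → ℂ} {r : ℝ}

theorem differentiableOn_dynZeta (h : ∀ z : ℂ, ‖z‖ < r → Summable (zetaTerm Z z)) :
    DifferentiableOn ℂ (dynZeta Z) (Metric.ball 0 r) := by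
  intro z hz
  rw [mem_ball_zero_iff] at hz
  -- Absolute convergence at the single point $\rho$ dominates the series on the disc of radius
  -- $\rho$.
  obtain ⟨ρ, hzρ, hρr⟩ := exists_between hz
  have hρ : 0 ≤ ρ := (norm_nonneg z).trans hzρ.le
  have hρn : ‖(ρ : ℂ)‖ = ρ := by rw [Complex.norm_real, Real.norm_of_nonneg hρ]
  have hd : DifferentiableOn ℂ (fun w => ∑' n, zetaTerm Z w n) (Metric.ball 0 ρ) := by
    refine Complex.differentiableOn_tsum_of_summable_norm (h (ρ : ℂ) (by rwa [hρn])).norm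
      (fun n => ?_) Metric.isOpen_ball fun n w hw => ?_
    · unfold zetaTerm
      fun_prop
    · have hw' : ‖w‖ ≤ ρ := (mem_ball_zero_iff.1 hw).le
      rw [zetaTerm, zetaTerm, norm_mul, norm_mul, norm_div, norm_div, norm_pow, norm_pow, hρn]
      gcongr
  exact (hd.differentiableAt (Metric.isOpen_ball.mem_nhds
    (mem_ball_zero_iff.2 hzρ))).cexp.differentiableWithinAt

/-- An identity `ζ E = P` near the origin persists on every disc on which the zeta function is
defined. -/
theorem dynZeta_mul_eq_of_eventually (h : ∀ z : ℂ, ‖z‖ < r → Summable (zetaTerm Z z))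
    {E P : ℂ → ℂ} (hE : Differentiable ℂ E) (hP : Differentiable ℂ P)
    (heq : ∀ᶠ z in 𝓝 0, dynZeta Z z * E z = P z) {z : ℂ} (hz : ‖z‖ < r) :
    dynZeta Z z * E z = P z := by
  have hr : 0 < r := (norm_nonneg z).trans_lt hz
  have h1 : AnalyticOnNhd ℂ (fun z => dynZeta Z z * E z) (Metric.ball 0 r) :=
    ((differentiableOn_dynZeta h).mul hE.differentiableOn).analyticOnNhd Metric.isOpen_ball
  have h2 : AnalyticOnNhd ℂ P (Metric.ball 0 r) := fun z _ => hP.analyticAt z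
  exact h1.eqOn_of_preconnected_of_eventuallyEq h2 (convex_ball (0 : ℂ) r).isPreconnected
    (Metric.mem_ball_self hr) heq (mem_ball_zero_iff.2 hz)

open Classical in
/-- The meromorphic continuation `P / E` of the zeta function, with the values of the zeta function
at the points where its power series converges. -/
def zetaContinuation (Z : ℕ → ℂ) (P E : ℂ → ℂ) (z : ℂ) : ℂ :=
  if ∃ r : ℝ, (∀ w : ℂ, ‖w‖ < r → Summable (zetaTerm Z w)) ∧ ‖z‖ < r then dynZeta Z z
  else P z / E z

variable {E P : ℂ → ℂ}

theorem zetaContinuation_eq_dynZeta (h : ∀ z : ℂ, ‖z‖ < r → Summable (zetaTerm Z z)) {z : ℂ}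
    (hz : ‖z‖ < r) : zetaContinuation Z P E z = dynZeta Z z :=
  if_pos ⟨r, h, hz⟩

/-- Only zeros of $E$ can separate the two branches. At such a zero inside the disc of convergence
$P$ vanishes too, and the quotient takes the default value $0$, whereas the zeta function is an
exponential. -/
theorem zetaContinuation_eq_div (hE : Differentiable ℂ E) (hP : Differentiable ℂ P)
    (heq : ∀ᶠ z in 𝓝 0, dynZeta Z z * E z = P z) {z : ℂ} (hz : E z ≠ 0) :
    zetaContinuation Z P E z = P z / E z := by
  unfold zetaContinuation
  split_ifs with h
  · obtain ⟨r, hr, hzr⟩ := h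
    rw [eq_div_iff hz]
    exact dynZeta_mul_eq_of_eventually hr hE hP heq hzr
  · rfl

theorem meromorphicOn_zetaContinuation (hE : Differentiable ℂ E) (hP : Differentiable ℂ P)
    (heq : ∀ᶠ z in 𝓝 0, dynZeta Z z * E z = P z) (hE0 : E 0 ≠ 0) :
    MeromorphicOn (zetaContinuation Z P E) Set.univ := by
  intro z _
  have h1 : MeromorphicAt (fun z => P z / E z) z :=
    (hP.analyticAt z).meromorphicAt.div (hE.analyticAt z).meromorphicAt
  refine h1.congr ?_
  have h3 : {z | E z ≠ 0} ∈ 𝓝[≠] z := by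
    simpa using mem_codiscreteWithin_iff_forall_mem_nhdsNE.1
      (setOf_ne_zero_mem_codiscrete hE hE0) z (Set.mem_univ z)
  filter_upwards [h3] with w hw
  exact (zetaContinuation_eq_div hE hP heq hw).symm

end Zeta

/-! ### Summation over the family near the origin -/

section Assembly

variable {n₀ : ℕ} {b : ℕ → ℕ → ℂ} {T : ℕ → ℝ} {C : ℝ} {Z : ℕ → ℂ} {z : ℂ}

theorem sum_zetaTerm (n₀ : ℕ) (Z : ℕ → ℂ) (z : ℂ) :
    ∑ i ∈ Finset.range (n₀ - 1), zetaTerm Z z i =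
      ∑ n ∈ Finset.Ico 1 n₀, z ^ n / (n : ℂ) * Z n := by
  rw [Finset.sum_Ico_eq_sum_range]
  refine Finset.sum_congr rfl fun i _ => ?_
  rw [zetaTerm, add_comm 1 i]
  push_cast
  rfl

/-- The double family is dominated by $T_\nu2^{-i}$, so it may be summed in either order; the terms
with $n<n_0$ form a separate finite sum. -/
theorem hasSum_zetaTerm (hT : Summable T) (hT0 : ∀ ν, 0 ≤ T ν) (hC : 1 ≤ C)
    (hb : ∀ ν i, ‖b ν i‖ ≤ T ν * C ^ i) (hb0 : ∀ ν i, ¬ n₀ ≤ i + 1 → b ν i = 0)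
    (hZ : ∀ i, n₀ ≤ i + 1 → HasSum (fun ν => (-1 : ℂ) ^ ν * b ν i) (Z (i + 1)))
    (hz : ‖z‖ < 1 / (2 * C)) :
    HasSum (zetaTerm Z z) ((∑ n ∈ Finset.Ico 1 n₀, z ^ n / (n : ℂ) * Z n) +
      ∑' ν : ℕ, (-1 : ℂ) ^ ν * ∑' i : ℕ, z ^ (i + 1) / ((i : ℂ) + 1) * b ν i) := by
  set F : ℕ × ℕ → ℂ := fun x =>
    (-1 : ℂ) ^ x.1 * (z ^ (x.2 + 1) / ((x.2 : ℂ) + 1) * b x.1 x.2) with hF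
  have hgeo : Summable fun i : ℕ => (1 / 2 : ℝ) ^ i :=
    summable_geometric_of_lt_one (by norm_num) (by norm_num)
  have hterm : ∀ ν (i : ℕ), ‖z ^ (i + 1) / ((i : ℂ) + 1) * b ν i‖ ≤ T ν * (1 / 2) ^ i :=
    fun ν => norm_log_term_le hC (hb ν) hz
  have hFs : Summable F := by
    refine Summable.of_norm_bounded (g := fun x : ℕ × ℕ => T x.1 * (1 / 2 : ℝ) ^ x.2)
      (hT.mul_of_nonneg hgeo hT0 fun i => by positivity) fun x => ?_
    rw [hF, norm_mul, norm_pow, norm_neg, norm_one, one_pow, one_mul]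
    exact hterm _ _
  have h1 : HasSum (fun ν : ℕ => (-1 : ℂ) ^ ν * ∑' i : ℕ, z ^ (i + 1) / ((i : ℂ) + 1) * b ν i)
      (∑' x, F x) := by
    have hν : ∀ ν, HasSum (fun i => F (ν, i))
        ((-1 : ℂ) ^ ν * ∑' i : ℕ, z ^ (i + 1) / ((i : ℂ) + 1) * b ν i) := fun ν => by
      have hs : Summable fun i : ℕ => z ^ (i + 1) / ((i : ℂ) + 1) * b ν i :=
        (hgeo.mul_left (T ν)).of_norm_bounded (hterm ν)
      exact hs.hasSum.mul_left ((-1 : ℂ) ^ ν)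
    exact hFs.hasSum.prod_fiberwise hν
  have h2 : HasSum (fun i => if n₀ ≤ i + 1 then zetaTerm Z z i else 0) (∑' x, F x) := by
    have hs : HasSum (F ∘ Equiv.prodComm ℕ ℕ) (∑' x, F x) :=
      (Equiv.prodComm ℕ ℕ).hasSum_iff.2 hFs.hasSum
    refine hs.prod_fiberwise fun i => ?_
    simp only [Function.comp_apply, Equiv.prodComm_apply, Prod.swap, hF]
    split_ifs with hi
    · have h := (hZ i hi).mul_left (z ^ (i + 1) / ((i : ℂ) + 1))
      rw [zetaTerm]
      convert! h using 1
      ext ν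
      ring
    · simp only [hb0 _ i hi, mul_zero]
      exact hasSum_zero
  have h3 : HasSum (fun i => if n₀ ≤ i + 1 then 0 else zetaTerm Z z i)
      (∑ i ∈ Finset.range (n₀ - 1), zetaTerm Z z i) := by
    have h := hasSum_sum_of_ne_finset_zero (L := .unconditional ℕ) (s := Finset.range (n₀ - 1))
      (f := fun i => if n₀ ≤ i + 1 then 0 else zetaTerm Z z i) (fun i hi => by
        rw [Finset.mem_range] at hi
        exact if_pos (by omega))
    rwa [Finset.sum_congr rfl (fun i hi => if_neg (by
      have := Finset.mem_range.1 hi; omega))] at h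
  rw [h1.tsum_eq, ← sum_zetaTerm]
  convert! h3.add h2 using 1
  ext i
  split_ifs <;> simp

theorem dynZeta_mul_tprod_eq (hT : Summable T) (hT0 : ∀ ν, 0 ≤ T ν) (hC : 1 ≤ C)
    (hb : ∀ ν i, ‖b ν i‖ ≤ T ν * C ^ i) (hb0 : ∀ ν i, ¬ n₀ ≤ i + 1 → b ν i = 0)
    (hZ : ∀ i, n₀ ≤ i + 1 → HasSum (fun ν => (-1 : ℂ) ^ ν * b ν i) (Z (i + 1)))
    (hz : ‖z‖ < 1 / (2 * C)) {ψ : ℕ → ℂ}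
    (hψ : ∀ ν, ψ ν = Complex.exp (-∑' i : ℕ, z ^ (i + 1) / ((i : ℂ) + 1) * b ν i)) :
    dynZeta Z z * ∏' ν, ψ (2 * ν) =
      Complex.exp (∑ n ∈ Finset.Ico 1 n₀, z ^ n / (n : ℂ) * Z n) * ∏' ν, ψ (2 * ν + 1) := by
  set L : ℕ → ℂ := fun ν => ∑' i : ℕ, z ^ (i + 1) / ((i : ℂ) + 1) * b ν i with hL
  have hgeo : Summable fun i : ℕ => (1 / 2 : ℝ) ^ i :=
    summable_geometric_of_lt_one (by norm_num) (by norm_num)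
  have hLs : Summable L := by
    refine (hT.mul_right (∑' i : ℕ, (1 / 2 : ℝ) ^ i)).of_norm_bounded fun ν => ?_
    rw [← tsum_mul_left]
    exact tsum_of_norm_bounded (hgeo.mul_left _).hasSum (norm_log_term_le hC (hb ν) hz)
  have he := (hLs.comp_injective (i := fun ν => 2 * ν) (fun a b hab => by simpa using hab)).hasSum
  have ho := (hLs.comp_injective (i := fun ν => 2 * ν + 1)
    (fun a b hab => by simpa using hab)).hasSum
  set Se := ∑' ν, (L ∘ fun ν => 2 * ν) ν
  set So := ∑' ν, (L ∘ fun ν => 2 * ν + 1) ν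
  have hsum : ∑' ν : ℕ, (-1 : ℂ) ^ ν * L ν = Se + -So := by
    refine (HasSum.even_add_odd (f := fun ν : ℕ => (-1 : ℂ) ^ ν * L ν) ?_ ?_).tsum_eq
    · simpa [pow_mul] using! he
    · simpa [pow_mul, pow_succ] using! ho.neg
  have hpe : ∏' ν, ψ (2 * ν) = Complex.exp (-Se) := by
    simp only [hψ]
    exact he.neg.cexp.tprod_eq
  have hpo : ∏' ν, ψ (2 * ν + 1) = Complex.exp (-So) := by
    simp only [hψ]
    exact ho.neg.cexp.tprod_eq
  rw [dynZeta, (hasSum_zetaTerm hT hT0 hC hb hb0 hZ hz).tsum_eq, hsum, hpe, hpo, ← Complex.exp_add,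
    ← Complex.exp_add]
  congr 1
  ring

theorem isLocallyDominated_of_detBound {ψ : ℕ → ℂ → ℂ} (hT : Summable T) (hT0 : ∀ ν, 0 ≤ T ν)
    (hTC : ∀ ν, T ν + 1 ≤ C)
    (h : ∀ ν r z, ‖z‖ ≤ r → ‖ψ ν z - 1‖ ≤ detBound n₀ (T ν) C r - 1) : IsLocallyDominated ψ := by
  intro r
  -- The maximum with $0$ covers negative $r$, for which the disc is empty. Below, $e^x-1\le xe^x$
  -- makes the bound linear in $T_\nu$.
  set a : ℝ := Real.exp (primaryExponent n₀ (max r 0 * C)) * max r 0 ^ n₀ with ha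
  have ha0 : 0 ≤ a := by positivity
  refine ⟨fun ν => a * Real.exp (a * C) * T ν, hT.mul_left _, fun ν z hz => ?_⟩
  refine (h ν (max r 0) z (hz.trans (le_max_left _ _))).trans ?_
  have hTν := hTC ν
  rw [detBound, ← ha]
  have h1 := Real.add_one_le_exp (-(a * T ν))
  have h2 : Real.exp (a * T ν) * Real.exp (-(a * T ν)) = 1 := by
    rw [← Real.exp_add, add_neg_cancel, Real.exp_zero]
  have h3 : Real.exp (a * T ν) - 1 ≤ a * T ν * Real.exp (a * T ν) := by
    nlinarith [Real.exp_pos (a * T ν)]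
  calc Real.exp (a * T ν) - 1 ≤ a * T ν * Real.exp (a * T ν) := h3
    _ ≤ a * T ν * Real.exp (a * C) := by
        gcongr
        · exact mul_nonneg ha0 (hT0 ν)
        · linarith
    _ = _ := by ring

end Assembly
end DynZeta

end

/-! ### The zeta function of the family -/

theorem theorem2p1 {H : ℕ → Type*} [∀ ν, NormedAddCommGroup (H ν)]
    [∀ ν, InnerProductSpace ℂ (H ν)] [∀ ν, CompleteSpace (H ν)]
    (n₀ : ℕ) (hn₀ : 1 ≤ n₀) (G : ∀ ν, H ν →L[ℂ] H ν)
    (hG : ∀ ν, DynZeta.MemSchatten n₀ (G ν))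
    (hsum : ∑' ν, DynZeta.schattenNorm 1 (G ν ^ n₀) < ∞)
    (Z : ℕ → ℂ)
    (hZ : ∀ n, n₀ ≤ n → Tendsto
      (fun N : ℕ => ∑ ν ∈ Finset.range N, (-1 : ℂ) ^ ν * DynZeta.opTrace (G ν ^ n))
      atTop (𝓝 (Z n))) :
    -- the determinants are entire functions of `z`
    (∀ ν, Differentiable ℂ (fun z : ℂ => DynZeta.regDet n₀ (z • G ν))) ∧
    -- the products of the determinants converge absolutely and locally uniformly on the plane
    SummableLocallyUniformlyOn
      (fun (ν : ℕ) (z : ℂ) => ‖DynZeta.regDet n₀ (z • G ν) - 1‖) Set.univ ∧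
    MultipliableLocallyUniformlyOn
      (fun (ν : ℕ) (z : ℂ) => DynZeta.regDet n₀ (z • G (2 * ν + 1))) Set.univ ∧
    MultipliableLocallyUniformlyOn
      (fun (ν : ℕ) (z : ℂ) => DynZeta.regDet n₀ (z • G (2 * ν))) Set.univ ∧
    -- off a closed discrete set, the factors with negative exponent do not vanish, and the
    -- product with alternating exponents converges locally uniformly
    {z : ℂ | ∀ ν, DynZeta.regDet n₀ (z • G (2 * ν)) ≠ 0} ∈ codiscrete ℂ ∧
    MultipliableLocallyUniformlyOn
      (fun (ν : ℕ) (z : ℂ) => DynZeta.regDet n₀ (z • G ν) ^ ((-1 : ℤ) ^ (ν + 1)))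
      {z : ℂ | ∀ ν, DynZeta.regDet n₀ (z • G (2 * ν)) ≠ 0} ∧
    -- the power series in the exponent of the zeta function has a positive radius of convergence
    (∃ r : ℝ, 0 < r ∧ ∀ z : ℂ, ‖z‖ < r → Summable (DynZeta.zetaTerm Z z)) ∧
    ∃ ζ : ℂ → ℂ,
      MeromorphicOn ζ Set.univ ∧
      -- `ζ` continues the zeta function from any disc on which the power series converges
      (∀ r : ℝ, (∀ z : ℂ, ‖z‖ < r → Summable (DynZeta.zetaTerm Z z)) →
        ∀ z : ℂ, ‖z‖ < r → ζ z = DynZeta.dynZeta Z z) ∧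
      ∀ z : ℂ, (∀ ν, DynZeta.regDet n₀ (z • G (2 * ν)) ≠ 0) →
        ζ z = Complex.exp (∑ n ∈ Finset.Ico 1 n₀, z ^ n / (n : ℂ) * Z n) *
            ∏' ν : ℕ, DynZeta.regDet n₀ (z • G ν) ^ ((-1 : ℤ) ^ (ν + 1)) ∧
        ζ z = Complex.exp (∑ n ∈ Finset.Ico 1 n₀, z ^ n / (n : ℂ) * Z n) *
            ((∏' ν : ℕ, DynZeta.regDet n₀ (z • G (2 * ν + 1))) /
              ∏' ν : ℕ, DynZeta.regDet n₀ (z • G (2 * ν))) := by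
  have hp : (1 : ℝ) ≤ n₀ := by exact_mod_cast hn₀
  -- The summable term $2^{-\nu}$ makes the bound on the trace norm strict, as the approximation by
  -- finite rank operators requires.
  set T : ℕ → ℝ := fun ν => (DynZeta.schattenNorm 1 (G ν ^ n₀)).toReal + (1 / 2) ^ ν with hTdef
  have hgeo : Summable fun ν : ℕ => (1 / 2 : ℝ) ^ ν :=
    summable_geometric_of_lt_one (by norm_num) (by norm_num)
  have hT : Summable T := (ENNReal.summable_toReal hsum.ne).add hgeo
  have hT0 : ∀ ν, 0 ≤ T ν := fun ν => by positivity
  have hTG : ∀ ν, DynZeta.schattenNorm 1 (G ν ^ n₀) < ENNReal.ofReal (T ν) := fun ν => by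
    have hfin := ENNReal.ne_top_of_tsum_ne_top hsum.ne ν
    rw [hTdef, ENNReal.ofReal_add ENNReal.toReal_nonneg (by positivity), ENNReal.ofReal_toReal hfin]
    exact ENNReal.lt_add_right hfin (by simp)
  set C : ℝ := ∑' ν, T ν + 1 with hCdef
  have hTC : ∀ ν, T ν + 1 ≤ C := fun ν => by
    rw [hCdef]
    gcongr
    exact hT.le_tsum ν fun μ _ => hT0 μ
  have hC : 1 ≤ C := by linarith [hTC 0, hT0 0]
  have hδ : 0 < 1 / (2 * C) := by positivity
  simp only [DynZeta.regDet_smul_eq_detSeries hn₀ (hG _)]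
  set ψ : ℕ → ℂ → ℂ := fun ν => DynZeta.detSeries n₀ (G ν) with hψdef
  have hψ : ∀ ν, Differentiable ℂ (ψ ν) := fun ν => DynZeta.differentiable_detSeries hn₀ (hG ν)
  have hdom : DynZeta.IsLocallyDominated ψ := DynZeta.isLocallyDominated_of_detBound hT hT0 hTC
    fun ν r z hz => DynZeta.norm_detSeries_sub_one_le hn₀ (hG ν) (hTG ν) (hTC ν) hz
  have hdomE := hdom.comp_injective (g := fun ν => 2 * ν) (fun a b hab => by simpa using hab)
  have hdomO := hdom.comp_injective (g := fun ν => 2 * ν + 1) (fun a b hab => by simpa using hab)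
  have hE := hdomE.differentiable_tprod fun ν => hψ (2 * ν)
  have hO := hdomO.differentiable_tprod fun ν => hψ (2 * ν + 1)
  have hb := fun ν => DynZeta.norm_traceSeq_le hn₀ (hG ν) (hTG ν) (hTC ν)
  have hb0 : ∀ ν i, ¬ n₀ ≤ i + 1 → DynZeta.traceSeq n₀ (G ν) i = 0 := fun ν i hi => if_neg hi
  -- The hypothesis gives only convergence of partial sums; the trace bounds make the series
  -- absolutely convergent with the same value.
  have hZs : ∀ i, n₀ ≤ i + 1 →
      HasSum (fun ν => (-1 : ℂ) ^ ν * DynZeta.traceSeq n₀ (G ν) i) (Z (i + 1)) := fun i hi => by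
    have hs : Summable fun ν => (-1 : ℂ) ^ ν * DynZeta.traceSeq n₀ (G ν) i :=
      (hT.mul_right (C ^ i)).of_norm_bounded fun ν => by
        rw [norm_mul, norm_pow, norm_neg, norm_one, one_pow, one_mul]
        exact hb ν i
    have hlim := hs.hasSum.tendsto_sum_nat
    simp only [DynZeta.traceSeq, if_pos hi] at hlim hs ⊢
    rw [tendsto_nhds_unique (hZ (i + 1) hi) hlim]
    exact hs.hasSum
  have hlog : ∀ ν z, ‖z‖ < 1 / (2 * C) → ψ ν z =
      Complex.exp (-∑' i : ℕ, z ^ (i + 1) / ((i : ℂ) + 1) * DynZeta.traceSeq n₀ (G ν) i) :=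
    fun ν z hz => DynZeta.detSeries_eq_exp hn₀ (hG ν) (hTG ν) (hTC ν) hz
  set P : ℂ → ℂ := fun z => Complex.exp (∑ n ∈ Finset.Ico 1 n₀, z ^ n / (n : ℂ) * Z n) *
    ∏' ν, ψ (2 * ν + 1) z with hPdef
  have hP : Differentiable ℂ P := Differentiable.mul (by fun_prop) hO
  have hnear : ∀ᶠ z in 𝓝 0, DynZeta.dynZeta Z z * ∏' ν, ψ (2 * ν) z = P z := by
    filter_upwards [Metric.ball_mem_nhds (0 : ℂ) hδ] with z hz
    rw [mem_ball_zero_iff] at hz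
    exact DynZeta.dynZeta_mul_tprod_eq hT hT0 hC hb hb0 hZs hz fun ν => hlog ν z hz
  have hE0 : ∏' ν, ψ (2 * ν) 0 ≠ 0 := by
    refine (hdomE.tprod_ne_zero_iff 0).2 fun ν => ?_
    rw [hlog (2 * ν) 0 (by simpa using hδ)]
    exact Complex.exp_ne_zero _
  have hUcod : {z : ℂ | ∀ ν, ψ (2 * ν) z ≠ 0} ∈ codiscrete ℂ := by
    rw [hdom.setOf_eq_tprod_ne_zero]
    exact DynZeta.setOf_ne_zero_mem_codiscrete hE hE0
  have hUopen : IsOpen {z : ℂ | ∀ ν, ψ (2 * ν) z ≠ 0} := by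
    rw [hdom.setOf_eq_tprod_ne_zero]
    exact isOpen_ne_fun hE.continuous continuous_const
  refine ⟨hψ, hdom.summableLocallyUniformlyOn,
    (hdomO.hasProdLocallyUniformlyOn fun ν => (hψ _).continuous).multipliableLocallyUniformlyOn,
    (hdomE.hasProdLocallyUniformlyOn fun ν => (hψ _).continuous).multipliableLocallyUniformlyOn,
    hUcod, hdom.multipliableLocallyUniformlyOn_zpow (fun ν => (hψ ν).continuous) hUopen
      (fun z hz => hz), ⟨1 / (2 * C), hδ, fun z hz =>
      (DynZeta.hasSum_zetaTerm hT hT0 hC hb hb0 hZs hz).summable⟩,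
    DynZeta.zetaContinuation Z P (fun z => ∏' ν, ψ (2 * ν) z),
    DynZeta.meromorphicOn_zetaContinuation hE hP hnear hE0,
    fun r hr z hz => DynZeta.zetaContinuation_eq_dynZeta hr hz, fun z hz => ?_⟩
  have hval := DynZeta.zetaContinuation_eq_div hE hP hnear ((hdomE.tprod_ne_zero_iff z).2 hz)
  have hval' : DynZeta.zetaContinuation Z P (fun z => ∏' ν, ψ (2 * ν) z) z =
      Complex.exp (∑ n ∈ Finset.Ico 1 n₀, z ^ n / (n : ℂ) * Z n) *
        ((∏' ν, ψ (2 * ν + 1) z) / ∏' ν, ψ (2 * ν) z) := by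
    rw [hval, hPdef, mul_div_assoc]
  exact ⟨by rw [hdom.tprod_zpow hz]; exact hval', hval'⟩
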